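/- Let $m, D$ be positive integers with $D \neq 1$ squarefree, let $F=\mathbb{Q}(\sqrt D)$ with ring of integers $\mathcal{O}_F$, and let $\mathcal{O}_F^+$ be the set of totally positive elements of $\mathcal{O}_F$. Put $\Delta=D$, $\omega=\frac{1+\sqrt D}{2}$, $\omega'=\frac{1-\sqrt D}{2}$ if $D\equiv 1 \pmod 4$, and $\Delta=4D$, $\omega=\sqrt D$, $\omega'=-\sqrt D$ otherwise. For an odd prime $p$ let $\gamma_p$ be the least positive quadratic non-residue modulo $p$, and put $\gamma_2=7$. A quadratic $\mathcal{O}_F$-lattice is a finitely generated $\mathcal{O}_F$-submodule $L$ of an $F$-vector space with a quadratic form $Q$ such that $Q(L)\subset \mathcal{O}_F$; its rank is the dimension of its $F$-span $FL$. It is classical if $\frac12\bigl(Q(v+w)-Q(v)-Q(w)\bigr)\in\mathcal{O}_F$ for all $v,w\in L$, and totally positive definite if $Q(x)$ is totally positive for every nonzero $x\in FL$. Let $L$ be a classical totally positive definite quadratic $\mathcal{O}_F$-lattice which represents every element of $m\mathcal{O}_F^+$, i.e. for each $\alpha\in\mathcal{O}_F^+$ there is $v\in L$ with $Q(v)=m\alpha$.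 Then there exist primes $p_1,p_2\le 2m^2$, integers $C_1, C_2$ with $2\le C_i\le\gamma_{p_i}$, primes $q_1,q_2$ with $q_i\le 2C_im^3$, and integers $D_1, D_2$ with $1\le D_i\le q_i\gamma_{q_i}$, such that all of the following hold: 1. if $\operatorname{rank} L\le 3$, then $\Delta\le 4C_1m^2\bigl(\omega-\lfloor\omega'\rfloor\bigr)$; 2. if $\operatorname{rank} L\le 4$, then $\Delta\le 4C_1m^2\bigl(2\omega-\lfloor 2\omega'\rfloor\bigr)$; 3. if $\operatorname{rank} L\le 5$, then $\Delta\le 4C_1m^2\bigl(C_2\omega-\lfloor C_2\omega'\rfloor\bigr)$ or $\sqrt{\Delta}^{\,3}\le 36C_2m^3\sqrt{\Delta}^{\,2}+18C_2m^3\sqrt{\Delta}+m^3$; 4. if $\operatorname{rank} L\le 6$, then $\Delta\le 4C_1m^2\bigl(C_2\omega-\lfloor C_2\omega'\rfloor\bigr)$ or $\sqrt{\Delta}^{\,3}\le 36C_2m^3\sqrt{\Delta}^{\,2}+18C_2m^3\sqrt{\Delta}+m^3$ or $\Delta\le 4D_1m^2\max\bigl\{C_1,\,C_2\omega-\lfloor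 C_2\omega'\rfloor\bigr\}$; 5. if $\operatorname{rank} L\le 7$, then $\Delta\le 4C_1D_1m^2$ or $\Delta\le 4\max\{C_1,D_1\}m^2\max\bigl\{C_2\omega-\lfloor C_2\omega'\rfloor,\,D_2\omega-\lfloor D_2\omega'\rfloor\bigr\}$ or $\sqrt{\Delta}^{\,3}\le 36C_2m^3\sqrt{\Delta}^{\,2}+18C_2m^3\sqrt{\Delta}+m^3$ or $\sqrt{\Delta}^{\,4}\le 192C_2D_2m^4\sqrt{\Delta}^{\,3}+144C_2D_2m^4\sqrt{\Delta}^{\,2}+96\max\{C_2,D_2\}m^4\sqrt{\Delta}+m^4$. (By contraposition, if all the inequalities in item 1, 2, 3, 4, or 5 fail, then $\operatorname{rank} L$ is at least 4, 5, 6, 7, or 8 respectively.) -/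

import Mathlib

open scoped NumberField

noncomputable section

/-- The real quadratic field `ℚ(√D)`, as a subfield of `ℝ`. -/
abbrev RealQuadField (D : ℕ) : IntermediateField ℚ ℝ :=
  IntermediateField.adjoin ℚ {Real.sqrt (D : ℝ)}

/-- The discriminant `Δ_D` of `ℚ(√D)`, for `D > 1` squarefree. -/
def quadDisc (D : ℕ) : ℕ := if D % 4 = 1 then D else 4 * D

/-- The integral generator `ω_D` of the ring of integers of `ℚ(√D)`, as a real number. -/
def quadOmega (D : ℕ) : ℝ :=
  if D % 4 = 1 then (1 + Real.sqrt D) / 2 else Real.sqrt D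

/-- The conjugate `ω_D'` of `ω_D`, as a real number. -/
def quadOmegaConj (D : ℕ) : ℝ :=
  if D % 4 = 1 then (1 - Real.sqrt D) / 2 else -Real.sqrt D

/-- The number `t ω_D - ⌊t ω_D'⌋`. -/
def quadShift (D t : ℕ) : ℝ :=
  (t : ℝ) * quadOmega D - (⌊(t : ℝ) * quadOmegaConj D⌋ : ℝ)

/-- `γ_p`: the least positive quadratic non-residue modulo `p` for an odd prime `p`;
by convention `γ_2 = 7`. -/
def leastNonresidue (p : ℕ) : ℕ :=
  if p = 2 then 7 else sInf {n : ℕ | 0 < n ∧ ¬ IsSquare (n : ZMod p)}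

/-- An element of a totally real number field `F` is totally positive if it is positive
under every embedding of `F` (all of which are real). -/
def IsTotallyPositive {F : Type*} [Field F] (a : F) : Prop :=
  ∀ σ : F →+* ℝ, 0 < σ a

section Lattices

variable {F V : Type*} [Field F] [AddCommGroup V] [Module F V] [Module (𝓞 F) V]

/-- The symmetric bilinear form `B(v, w) = (Q(v + w) - Q(v) - Q(w)) / 2` of a quadratic form. -/
def latticeB (Q : QuadraticForm F V) (v w : V) : F := (Q (v + w) - Q v - Q w) / 2

/-- A quadratic `𝓞 F`-lattice in the quadratic space `(V, Q)`: a finitely generated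
`𝓞 F`-submodule `L` of `V` with `Q(L) ⊆ 𝓞 F`. -/
structure IsQuadraticLattice (Q : QuadraticForm F V) (L : Submodule (𝓞 F) V) : Prop where
  fg : L.FG
  integral : ∀ v ∈ L, ∃ a : 𝓞 F, Q v = algebraMap (𝓞 F) F a

/-- The lattice is classical if `B(L, L) ⊆ 𝓞 F`. -/
def IsClassicalLattice (Q : QuadraticForm F V) (L : Submodule (𝓞 F) V) : Prop :=
  ∀ v ∈ L, ∀ w ∈ L, ∃ a : 𝓞 F, latticeB Q v w = algebraMap (𝓞 F) F a

/-- The quadratic space `F L = L ⊗ F` of a lattice `L`: the `F`-span of `L` in `V`. -/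
def latticeSpace (L : Submodule (𝓞 F) V) : Submodule F V := Submodule.span F (L : Set V)

/-- The rank of a lattice is the dimension of the `F`-space it spans. -/
def latticeRank (L : Submodule (𝓞 F) V) : ℕ := Module.finrank F (latticeSpace L)

/-- The lattice is totally positive definite if `Q` takes totally positive values on all
nonzero vectors of the quadratic space of `L`. -/
def IsTotPosDefLattice (Q : QuadraticForm F V) (L : Submodule (𝓞 F) V) : Prop :=
  ∀ x ∈ latticeSpace L, x ≠ 0 → IsTotallyPositive (Q x)

/-- The lattice represents every element of `m 𝓞_F⁺`, where `𝓞_F⁺` is the set of totally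
positive elements of `𝓞 F`. -/
def RepresentsMultiples (Q : QuadraticForm F V) (L : Submodule (𝓞 F) V) (m : ℕ) : Prop :=
  ∀ a : 𝓞 F, IsTotallyPositive (algebraMap (𝓞 F) F a) →
    ∃ v ∈ L, Q v = (m : F) * algebraMap (𝓞 F) F a

end Lattices

end

/-! ### Quadratic residues and infinite descent -/

section

open scoped NumberTheorySymbols

/-! Write s = √Δ = ω − ω', and let σ, τ be the two real embeddings of F. For v, w in L one has B(v,
w) = a + nω with integers a, n, and σ(B) − τ(B) = sn. Cauchy–Schwarz under both embeddings bounds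
|sn|, so n = 0 whenever the norms are small compared with s (`map_latticeB_eq_of_lt`).

Take vectors v of norms m, 2m, C₁m, D₁m, and vectors w of norms m(tω − ⌊tω'⌋) for t = 1, 2, C₂, D₂,
whose norms under τ lie between 0 and m. If Δ is large, all products among the v's, and between the
v's and the w's, are rational integers. The σ-Gram matrix of the whole family is then the τ-Gram
matrix, which is positive semidefinite, plus s times the integer matrix N of ω-coordinates, placed
in the w-block. If the v-block is nondegenerate and N is positive definite, the sum is positive
definite, the vectors are independent, and the rank is bounded below
(`card_add_card_le_latticeRank`). The five items use 3+1, 3+2, 3+3, 4+3 and 4+4 vectors.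

For k vectors w, the matrix N + (km/s)·1 is positive semidefinite. For s large this forces the
leading minors of N above −1; they are integers, so once they are nonzero they are positive, and
Sylvester's criterion applies.

The numbers C and D are chosen to keep the minors nonzero. The 2×2 minor 2m² − b² never vanishes, as
√2 is irrational. If an extension by a vector of norm Cm were degenerate, then x² + dy² with d = 2m²
− b² would represent C over ℚ; a residue obstruction excludes this for a small C
(`exists_not_represented_binary`). Likewise a degenerate 4×4 extension makes a positive ternary form
represent D over ℚ. Such a form is anisotropic at the real place, hence by reciprocity at some
finite prime q, and there it misses a class with a representative D ≤ qγ_q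
(`exists_not_represented_ternary`). -/

theorem eq_zero_of_forall_exists_mul {q : ℤ} (hq : 1 < q) (S : Set ℤ)
    (h : ∀ w ∈ S, ∃ w' ∈ S, w = q * w') : ∀ w ∈ S, w = 0 := by
  have key : ∀ n : ℕ, ∀ w ∈ S, w.natAbs = n → w = 0 := by
    intro n
    induction n using Nat.strong_induction_on with
    | _ n ih =>
      intro w hw hn
      obtain ⟨w', hw', rfl⟩ := h w hw
      by_contra hne
      have hw0 : w' ≠ 0 := fun h0 => hne (by rw [h0, mul_zero])
      have hlt : w'.natAbs < n := by
        rw [← hn, Int.natAbs_mul]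
        have h1 : 0 < w'.natAbs := Int.natAbs_pos.2 hw0
        have h2 : 1 < q.natAbs := by omega
        nlinarith
      exact hw0 (ih _ hlt w' hw' rfl)
  exact fun w hw => key _ w hw rfl

theorem leastNonresidue_spec {p : ℕ} [Fact p.Prime] (hp : p ≠ 2) :
    2 ≤ leastNonresidue p ∧ legendreSym p (leastNonresidue p) = -1 := by
  have hne : {n : ℕ | 0 < n ∧ ¬ IsSquare (n : ZMod p)}.Nonempty := by
    obtain ⟨a, ha⟩ := FiniteField.exists_nonsquare (F := ZMod p) (by rwa [ZMod.ringChar_zmod_n])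
    refine ⟨a.val, Nat.pos_of_ne_zero fun h0 => ?_, by rwa [ZMod.natCast_zmod_val]⟩
    rw [ZMod.val_eq_zero] at h0
    exact ha (h0 ▸ IsSquare.zero)
  have hmem := Nat.sInf_mem hne
  rw [leastNonresidue, if_neg hp]
  refine ⟨?_, ?_⟩
  · by_contra hlt
    have h1 : sInf {n : ℕ | 0 < n ∧ ¬ IsSquare (n : ZMod p)} = 1 := by
      have := hmem.1
      omega
    rw [h1] at hmem
    exact hmem.2 (by simp)
  · rw [legendreSym.eq_neg_one_iff]
    exact_mod_cast hmem.2

theorem not_dvd_of_legendreSym_eq_neg_one {p : ℕ} [Fact p.Prime] {a : ℤ}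
    (h : legendreSym p a = -1) : ¬ (p : ℤ) ∣ a := by
  intro hd
  rw [← ZMod.intCast_zmod_eq_zero_iff_dvd, ← legendreSym.eq_zero_iff, h] at hd
  norm_num at hd

/-- Multiplying by B gives (By)² − (−BC)z², which is anisotropic modulo p when −BC is a non-residue.
-/
theorem dvd_of_dvd_mul_sq_add_mul_sq {p : ℕ} [hp : Fact p.Prime] {B C y z : ℤ}
    (h : legendreSym p (-(B * C)) = -1) (hd : (p : ℤ) ∣ B * y ^ 2 + C * z ^ 2) :
    (p : ℤ) ∣ y ∧ (p : ℤ) ∣ z := by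
  have hB : ¬ (p : ℤ) ∣ B := fun hB =>
    not_dvd_of_legendreSym_eq_neg_one h (Dvd.dvd.neg_right (hB.mul_right C))
  have h1 : (p : ℤ) ∣ (B * y) ^ 2 - -(B * C) * z ^ 2 := by
    have : (B * y) ^ 2 - -(B * C) * z ^ 2 = B * (B * y ^ 2 + C * z ^ 2) := by ring
    rw [this]; exact hd.mul_left B
  obtain ⟨h2, h3⟩ := legendreSym.prime_dvd_of_eq_neg_one h h1
  exact ⟨((Nat.prime_iff_prime_int.1 hp.out).dvd_or_dvd h2).resolve_left hB, h3⟩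

/-- By multiplicativity, u = γ_p works if K is a residue and u = 1 works otherwise. -/
theorem exists_legendreSym_mul_eq_neg_one {p : ℕ} [hp : Fact p.Prime] (hp2 : p ≠ 2) {K : ℤ}
    (hK : ¬ (p : ℤ) ∣ K) :
    ∃ u : ℕ, 1 ≤ u ∧ u ≤ leastNonresidue p ∧ legendreSym p (K * u) = -1 := by
  obtain ⟨h2, hγ⟩ := leastNonresidue_spec hp2
  have hK' : (K : ZMod p) ≠ 0 := by rwa [Ne, ZMod.intCast_zmod_eq_zero_iff_dvd]
  rcases legendreSym.eq_one_or_neg_one p hK' with h | h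
  · exact ⟨leastNonresidue p, by omega, le_rfl, by rw [legendreSym.mul, h, hγ]; norm_num⟩
  · exact ⟨1, le_rfl, by omega, by simpa using h⟩

/-- A binary form `x² + d y²` does not represent some small integer over `ℚ`. -/
theorem exists_not_represented_binary (d : ℕ) (hd : 0 < d) :
    ∃ p C : ℕ, p.Prime ∧ p ≤ max 2 d ∧ 2 ≤ C ∧ C ≤ leastNonresidue p ∧
      ∀ x y w : ℤ, x ^ 2 + d * y ^ 2 = C * w ^ 2 → w = 0 := by
  obtain ⟨a, b, hab, hsq⟩ := Nat.sq_mul_squarefree d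
  have ha0 : a ≠ 0 := hsq.ne_zero
  by_cases hodd : ∃ p : ℕ, p.Prime ∧ p ≠ 2 ∧ p ∣ a
  · obtain ⟨p, hp, hp2, c, rfl⟩ := hodd
    have : Fact p.Prime := ⟨hp⟩
    obtain ⟨h2, hγ⟩ := leastNonresidue_spec hp2
    have hpi := Nat.prime_iff_prime_int.1 hp
    have hpc : ¬ (p : ℤ) ∣ c := by
      intro h
      obtain ⟨e, rfl⟩ := Int.natCast_dvd_natCast.1 h
      exact hp.not_isUnit (hsq p ⟨e, by ring⟩)
    -- Modulo p the equation reads x² ≡ γ_p w², which forces p to divide x and w. Then p divides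
    -- cy², hence y, and the solution descends. The square b² is first absorbed into y.
    refine ⟨p, leastNonresidue p, hp, le_max_of_le_right (Nat.le_of_dvd hd ?_), h2, le_rfl, ?_⟩
    · rw [← hab]; exact Dvd.dvd.mul_left (dvd_mul_right p c) _
    intro x y w h
    refine eq_zero_of_forall_exists_mul (q := p) (by exact_mod_cast hp.one_lt)
      {w : ℤ | ∃ x y : ℤ, x ^ 2 + p * c * y ^ 2 = leastNonresidue p * w ^ 2} ?_ w
      ⟨x, b * y, by rw [← h, ← hab]; push_cast; ring⟩
    rintro w ⟨x, y, h⟩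
    have h1 : (p : ℤ) ∣ x ^ 2 - (leastNonresidue p : ℤ) * w ^ 2 :=
      ⟨-(c * y ^ 2), by linear_combination h⟩
    obtain ⟨⟨x', rfl⟩, ⟨w', rfl⟩⟩ := legendreSym.prime_dvd_of_eq_neg_one hγ h1
    have hp0 : (p : ℤ) ≠ 0 := by exact_mod_cast hp.ne_zero
    have h3 : (p : ℤ) ∣ c * y ^ 2 := by
      refine ⟨leastNonresidue p * w' ^ 2 - x' ^ 2, ?_⟩
      apply mul_left_cancel₀ hp0
      linear_combination h
    obtain ⟨y', rfl⟩ := hpi.dvd_of_dvd_pow ((hpi.dvd_or_dvd h3).resolve_left hpc)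
    refine ⟨w', ⟨x', y', ?_⟩, rfl⟩
    apply mul_left_cancel₀ (pow_ne_zero 2 hp0)
    linear_combination h
  · push Not at hodd
    have ha : a = 1 ∨ a = 2 := by
      have h2 : ∀ p, p.Prime → p ∣ a → p = 2 := fun p hp hpa => by
        by_contra h; exact hodd p hp h hpa
      have := Nat.eq_prime_pow_of_unique_prime_dvd ha0 (fun {p} hp hpa => h2 p hp hpa)
      rw [this] at hsq ⊢
      rcases Nat.lt_or_ge a.primeFactorsList.length 2 with hl | hl
      · interval_cases a.primeFactorsList.length <;> simp
      · exact absurd (hsq 2 ⟨2 ^ (a.primeFactorsList.length - 2), by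
          rw [← sq, ← pow_add]; congr 1; omega⟩) (by decide)
    rcases ha with rfl | rfl
    · have hns : ¬ IsSquare (-1 : ZMod 3) := by decide
      have : Fact (Nat.Prime 3) := ⟨by norm_num⟩
      -- The obstruction to C = 3 lives at the prime 3, where −1 is not a square. The prime recorded
      -- is 2, and C is admissible because γ_2 = 7.
      refine ⟨2, 3, Nat.prime_two, le_max_left _ _, by norm_num, by simp [leastNonresidue], ?_⟩
      intro x y w h
      refine eq_zero_of_forall_exists_mul (q := 3) (by norm_num)
        {w : ℤ | ∃ x y : ℤ, x ^ 2 + y ^ 2 = 3 * w ^ 2} ?_ w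
        ⟨x, b * y, by push_cast at h; rw [← h, ← hab]; push_cast; ring⟩
      rintro w ⟨x, y, h⟩
      obtain ⟨⟨x', rfl⟩, ⟨y', rfl⟩⟩ := dvd_of_dvd_mul_sq_add_mul_sq (p := 3) (B := 1) (C := 1)
        (y := x) (z := y) (by rw [legendreSym.eq_neg_one_iff]; push_cast; simpa using hns) ⟨w ^ 2, by push_cast; linear_combination h⟩
      have h3 : (3 : ℤ) ∣ w ^ 2 := ⟨x' ^ 2 + y' ^ 2, by push_cast at h; linarith⟩
      obtain ⟨w', rfl⟩ := Int.prime_three.dvd_of_dvd_pow h3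
      exact ⟨w', ⟨x', y', by push_cast at h; linarith⟩, rfl⟩
    · have hns : ¬ IsSquare (-2 : ZMod 5) := by decide
      have : Fact (Nat.Prime 5) := ⟨by norm_num⟩
      -- As before, with −2 a non-square modulo 5 and 5 ≤ γ_2.
      refine ⟨2, 5, Nat.prime_two, le_max_left _ _, by norm_num, by simp [leastNonresidue], ?_⟩
      intro x y w h
      refine eq_zero_of_forall_exists_mul (q := 5) (by norm_num)
        {w : ℤ | ∃ x y : ℤ, x ^ 2 + 2 * y ^ 2 = 5 * w ^ 2} ?_ w
        ⟨x, b * y, by push_cast at h; rw [← h, ← hab]; push_cast; ring⟩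
      rintro w ⟨x, y, h⟩
      obtain ⟨⟨x', rfl⟩, ⟨y', rfl⟩⟩ := dvd_of_dvd_mul_sq_add_mul_sq (p := 5) (B := 1) (C := 2)
        (y := x) (z := y) (by rw [legendreSym.eq_neg_one_iff]; push_cast; simpa using hns) ⟨w ^ 2, by push_cast; linear_combination h⟩
      have h3 : (5 : ℤ) ∣ w ^ 2 := ⟨x' ^ 2 + 2 * y' ^ 2, by push_cast at h; linarith⟩
      obtain ⟨w', rfl⟩ := (Nat.prime_iff_prime_int.1 Nat.prime_five).dvd_of_dvd_pow h3
      exact ⟨w', ⟨x', y', by push_cast at h ⊢; linarith⟩, rfl⟩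

/-- The descent at an odd prime for quaternary diagonal equations. -/
theorem eq_zero_of_legendreSym_eq_neg_one {q : ℕ} [hq : Fact q.Prime] {A B C E : ℤ}
    (hBC : legendreSym q (-(B * C)) = -1) (hAE : legendreSym q (A * E) = -1) (x y z w : ℤ)
    (h : q * A * x ^ 2 + B * y ^ 2 + C * z ^ 2 = q * E * w ^ 2) : w = 0 := by
  have hq0 : (q : ℤ) ≠ 0 := by exact_mod_cast hq.out.ne_zero
  refine eq_zero_of_forall_exists_mul (q := q) (by exact_mod_cast hq.out.one_lt)
    {w : ℤ | ∃ x y z : ℤ, q * A * x ^ 2 + B * y ^ 2 + C * z ^ 2 = q * E * w ^ 2} ?_ w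
    ⟨x, y, z, h⟩
  rintro w ⟨x, y, z, h⟩
  obtain ⟨⟨y', rfl⟩, ⟨z', rfl⟩⟩ := dvd_of_dvd_mul_sq_add_mul_sq (y := y) (z := z) hBC
    ⟨E * w ^ 2 - A * x ^ 2, by linear_combination h⟩
  -- After y and z are divided by q, the whole equation can be divided by q. What is left modulo q
  -- is Ax² − Ew², anisotropic because AE is a non-residue.
  have h1 : (q : ℤ) ∣ A * x ^ 2 + (-E) * w ^ 2 := by
    refine ⟨-(B * y' ^ 2 + C * z' ^ 2), mul_left_cancel₀ hq0 ?_⟩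
    linear_combination h
  obtain ⟨⟨x', rfl⟩, ⟨w', rfl⟩⟩ := dvd_of_dvd_mul_sq_add_mul_sq (y := x) (z := w)
    (by simpa using hAE) h1
  refine ⟨w', ⟨x', y', z', mul_left_cancel₀ (pow_ne_zero 2 hq0) ?_⟩, rfl⟩
  linear_combination h

end

/-! ### Anisotropy at the prime `2` -/

section

open scoped NumberTheorySymbols

theorem jacobiSym_mul_jacobiSym_swap {a b : ℕ} (ha : Odd a) (hb : Odd b) (hab : a.Coprime b) :
    J(a | b) * J(b | a) = if a % 4 = 1 ∨ b % 4 = 1 then 1 else -1 := by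
  have hsq : J(b | a) * J(b | a) = 1 := by
    rw [← sq]
    exact jacobiSym.sq_one (by rw [Int.gcd_natCast_natCast]; exact hab.symm)
  have ha4 := Nat.odd_mod_four_iff.1 (Nat.odd_iff.1 ha)
  have hb4 := Nat.odd_mod_four_iff.1 (Nat.odd_iff.1 hb)
  rcases ha4 with ha4 | ha4
  · rw [jacobiSym.quadratic_reciprocity_one_mod_four ha4 hb, hsq, if_pos (Or.inl ha4)]
  rcases hb4 with hb4 | hb4
  · rw [jacobiSym.quadratic_reciprocity_one_mod_four' ha hb4, hsq, if_pos (Or.inr hb4)]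
  · rw [jacobiSym.quadratic_reciprocity_three_mod_four ha4 hb4, neg_mul, hsq, if_neg (by omega)]

theorem chi_four_of_odd {a : ℕ} (ha : Odd a) : ZMod.χ₄ a = if a % 4 = 1 then 1 else -1 := by
  rw [ZMod.χ₄_nat_eq_if_mod_four, if_neg (by have := Nat.odd_iff.1 ha; omega)]

/-- The product of the three Legendre conditions for an odd ternary form. -/
theorem jacobiSym_ternary {a b c : ℕ} (ha : Odd a) (hb : Odd b) (hc : Odd c)
    (hab : a.Coprime b) (hac : a.Coprime c) (hbc : b.Coprime c) :
    J(-(b * c) | a) * J(-(a * c) | b) * J(-(a * b) | c) =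
      if a % 4 = b % 4 ∧ b % 4 = c % 4 then 1 else -1 := by
  rw [jacobiSym.neg _ ha, jacobiSym.neg _ hb, jacobiSym.neg _ hc, jacobiSym.mul_left,
    jacobiSym.mul_left, jacobiSym.mul_left, chi_four_of_odd ha, chi_four_of_odd hb,
    chi_four_of_odd hc]
  have h1 := jacobiSym_mul_jacobiSym_swap ha hb hab
  have h2 := jacobiSym_mul_jacobiSym_swap ha hc hac
  have h3 := jacobiSym_mul_jacobiSym_swap hb hc hbc
  -- The symbols group into three reciprocity pairs and three signs χ₄; the result depends only on
  -- a, b, c modulo 4.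
  calc _ = (if a % 4 = 1 then (1 : ℤ) else -1) * (if b % 4 = 1 then 1 else -1) *
        (if c % 4 = 1 then 1 else -1) * (J(a | b) * J(b | a)) * (J(a | c) * J(c | a)) *
        (J(b | c) * J(c | b)) := by ring
    _ = _ := by
      rw [h1, h2, h3]
      rcases Nat.odd_mod_four_iff.1 (Nat.odd_iff.1 ha) with ha4 | ha4 <;>
      rcases Nat.odd_mod_four_iff.1 (Nat.odd_iff.1 hb) with hb4 | hb4 <;>
      rcases Nat.odd_mod_four_iff.1 (Nat.odd_iff.1 hc) with hc4 | hc4 <;>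
      simp [ha4, hb4, hc4]

theorem zmod_eight_sq_of_odd {x : ℤ} (h : Odd x) : (x : ZMod 8) ^ 2 = 1 := by
  obtain ⟨k, rfl⟩ := h
  push_cast
  generalize (k : ZMod 8) = t
  revert t
  decide

theorem zmod_eight_sq (x : ℤ) : (x : ZMod 8) ^ 2 ∈ ({0, 1, 4} : Finset (ZMod 8)) := by
  generalize (x : ZMod 8) = t
  revert t
  decide

theorem zmod_eight_of_odd {x : ℤ} (h : Odd x) :
    (x : ZMod 8) ∈ ({1, 3, 5, 7} : Finset (ZMod 8)) := by
  obtain ⟨k, rfl⟩ := h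
  push_cast
  generalize (k : ZMod 8) = t
  revert t
  decide

/-- In `ZMod 8`, 2a = 2b means a ≡ b modulo 4, and 0, 1, 4 are the squares, with 1 the only odd one.
The table says that ⟨a, b, c, abc⟩ has no zero modulo 8 with an odd coordinate. -/
theorem zmod_eight_table_odd : ∀ a ∈ ({1, 3, 5, 7} : Finset (ZMod 8)),
    ∀ b ∈ ({1, 3, 5, 7} : Finset (ZMod 8)), ∀ c ∈ ({1, 3, 5, 7} : Finset (ZMod 8)),
    2 * a = 2 * b → 2 * b = 2 * c → ∀ x ∈ ({0, 1, 4} : Finset (ZMod 8)),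
    ∀ y ∈ ({0, 1, 4} : Finset (ZMod 8)), ∀ z ∈ ({0, 1, 4} : Finset (ZMod 8)),
    ∀ w ∈ ({0, 1, 4} : Finset (ZMod 8)), a * x + b * y + c * z = -(a * b * c) * w →
    x ≠ 1 ∧ y ≠ 1 ∧ z ≠ 1 ∧ w ≠ 1 := by
  decide

/-- The first inequality excludes y, z odd in 2ax² + by² + cz² = 2ew² with e ≡ −abc. The second
excludes x, w odd after y, z have been halved and the equation divided by 2. -/
theorem zmod_eight_table_even : ∀ a ∈ ({1, 3, 5, 7} : Finset (ZMod 8)),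
    ∀ b ∈ ({1, 3, 5, 7} : Finset (ZMod 8)), ∀ c ∈ ({1, 3, 5, 7} : Finset (ZMod 8)),
    ((b * c = 1 ∨ b * c = 7) ↔ (2 * a = 2 * b ∧ 2 * b = 2 * c)) →
    ∀ x ∈ ({0, 1, 4} : Finset (ZMod 8)), ∀ y ∈ ({0, 1, 4} : Finset (ZMod 8)),
    b + c + 2 * a * x ≠ 2 * -(a * b * c) * y ∧ a + 2 * b * x + 2 * c * y ≠ -(a * b * c) := by
  decide

theorem not_odd_of_zmod_eight_sq_ne_one {x : ℤ} (h : (x : ZMod 8) ^ 2 ≠ 1) : ∃ y, x = 2 * y := by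
  obtain ⟨y, hy⟩ := Int.not_odd_iff_even.1 fun ho => h (zmod_eight_sq_of_odd ho)
  exact ⟨y, by omega⟩

theorem eq_zero_of_odd_two_adic {a b c e : ℤ} (ha : Odd a) (hb : Odd b) (hc : Odd c)
    (hab : 2 * (a : ZMod 8) = 2 * b) (hbc : 2 * (b : ZMod 8) = 2 * c)
    (he : (e : ZMod 8) = -(a * b * c)) (x y z w : ℤ)
    (h : a * x ^ 2 + b * y ^ 2 + c * z ^ 2 = e * w ^ 2) : w = 0 := by
  refine eq_zero_of_forall_exists_mul (q := 2) (by norm_num)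
    {w : ℤ | ∃ x y z : ℤ, a * x ^ 2 + b * y ^ 2 + c * z ^ 2 = e * w ^ 2} ?_ w ⟨x, y, z, h⟩
  rintro w ⟨x, y, z, h⟩
  have h8 := congrArg (Int.cast : ℤ → ZMod 8) h
  push_cast at h8
  rw [he] at h8
  obtain ⟨hx, hy, hz, hw⟩ := zmod_eight_table_odd _ (zmod_eight_of_odd ha) _ (zmod_eight_of_odd hb)
    _ (zmod_eight_of_odd hc) hab hbc _ (zmod_eight_sq x) _ (zmod_eight_sq y) _ (zmod_eight_sq z)
    _ (zmod_eight_sq w) h8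
  obtain ⟨x', rfl⟩ := not_odd_of_zmod_eight_sq_ne_one hx
  obtain ⟨y', rfl⟩ := not_odd_of_zmod_eight_sq_ne_one hy
  obtain ⟨z', rfl⟩ := not_odd_of_zmod_eight_sq_ne_one hz
  obtain ⟨w', rfl⟩ := not_odd_of_zmod_eight_sq_ne_one hw
  exact ⟨w', ⟨x', y', z', by linarith⟩, rfl⟩

/-- Descent in two rounds: parity makes y and z both odd or both even, and the oddness is excluded
modulo 8. After halving them and dividing by 2, the same happens with x and w. -/
theorem eq_zero_of_even_two_adic {a b c e : ℤ} (ha : Odd a) (hb : Odd b) (hc : Odd c)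
    (habc : ((b * c : ZMod 8) = 1 ∨ (b * c : ZMod 8) = 7) ↔
      (2 * (a : ZMod 8) = 2 * b ∧ 2 * (b : ZMod 8) = 2 * c))
    (he : (e : ZMod 8) = -(a * b * c)) (x y z w : ℤ)
    (h : 2 * a * x ^ 2 + b * y ^ 2 + c * z ^ 2 = 2 * e * w ^ 2) : w = 0 := by
  have he2 : Odd e := by
    by_contra hne
    obtain ⟨k, hk⟩ := Int.not_odd_iff_even.1 hne
    have h1 : ∀ t ∈ ({1, 3, 5, 7} : Finset (ZMod 8)), ∀ k : ZMod 8, k + k ≠ -t := by decide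
    refine h1 _ (zmod_eight_of_odd ((ha.mul hb).mul hc)) k ?_
    push_cast
    rw [← he, hk]
    push_cast
    ring
  refine eq_zero_of_forall_exists_mul (q := 2) (by norm_num)
    {w : ℤ | ∃ x y z : ℤ, 2 * a * x ^ 2 + b * y ^ 2 + c * z ^ 2 = 2 * e * w ^ 2} ?_ w ⟨x, y, z, h⟩
  rintro w ⟨x, y, z, h⟩
  have hT := zmod_eight_table_even _ (zmod_eight_of_odd ha) _ (zmod_eight_of_odd hb)
    _ (zmod_eight_of_odd hc) habc
  have hev : Even (b * y ^ 2 + c * z ^ 2) := ⟨e * w ^ 2 - a * x ^ 2, by linear_combination h⟩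
  have hyz : Odd y ↔ Odd z := by
    have := Int.even_add.1 hev
    simp only [Int.even_mul, Int.not_even_iff_odd.2 hb, Int.not_even_iff_odd.2 hc, false_or,
      Int.even_pow, ne_eq, OfNat.ofNat_ne_zero, not_false_eq_true, and_true] at this
    rw [← Int.not_even_iff_odd, ← Int.not_even_iff_odd, this]
  by_cases hy : Odd y
  · have h8 := congrArg (Int.cast : ℤ → ZMod 8) h
    push_cast at h8
    rw [zmod_eight_sq_of_odd hy, zmod_eight_sq_of_odd (hyz.1 hy), he] at h8
    exact absurd (by linear_combination h8) (hT _ (zmod_eight_sq x) _ (zmod_eight_sq w)).1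
  · have hz : ¬ Odd z := fun h => hy (hyz.2 h)
    obtain ⟨y', hy'⟩ := Int.not_odd_iff_even.1 hy
    obtain ⟨z', hz'⟩ := Int.not_odd_iff_even.1 hz
    obtain rfl : y = 2 * y' := by omega
    obtain rfl : z = 2 * z' := by omega
    have h2 : a * x ^ 2 + 2 * b * y' ^ 2 + 2 * c * z' ^ 2 = e * w ^ 2 := by linarith
    have hxw : Odd x ↔ Odd w := by
      have : Even (a * x ^ 2 + e * w ^ 2) :=
        ⟨e * w ^ 2 - b * y' ^ 2 - c * z' ^ 2, by linear_combination h2⟩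
      have := Int.even_add.1 this
      simp only [Int.even_mul, Int.not_even_iff_odd.2 ha, Int.not_even_iff_odd.2 he2, false_or,
        Int.even_pow, ne_eq, OfNat.ofNat_ne_zero, not_false_eq_true, and_true] at this
      rw [← Int.not_even_iff_odd, ← Int.not_even_iff_odd, this]
    by_cases hx : Odd x
    · have h8 := congrArg (Int.cast : ℤ → ZMod 8) h2
      push_cast at h8
      rw [zmod_eight_sq_of_odd hx, zmod_eight_sq_of_odd (hxw.1 hx), he] at h8
      exact absurd (by linear_combination h8) (hT _ (zmod_eight_sq y') _ (zmod_eight_sq z')).2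
    · have hw : ¬ Odd w := fun h => hx (hxw.2 h)
      obtain ⟨x', hx'⟩ := Int.not_odd_iff_even.1 hx
      obtain ⟨w', hw'⟩ := Int.not_odd_iff_even.1 hw
      obtain rfl : x = 2 * x' := by omega
      obtain rfl : w = 2 * w' := by omega
      exact ⟨w', ⟨x', y', z', by linarith⟩, rfl⟩

end

/-! ### Positive ternary forms are not universal over `ℚ` -/

section

open scoped NumberTheorySymbols

theorem two_mul_zmod_eight_eq_iff (a b : ℕ) :
    2 * (a : ZMod 8) = 2 * b ↔ a % 4 = b % 4 := by
  have h := ZMod.natCast_eq_natCast_iff (2 * a) (2 * b) 8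
  push_cast at h
  rw [h, Nat.ModEq]
  omega

/-- Reciprocity for ⟨2a, b, c⟩: the product of the three conditions is χ₈(bc) times the sign of
`jacobiSym_ternary`, so the two signs agree. This is the hypothesis needed for anisotropy at 2. -/
theorem zmod_eight_condition_of_jacobiSym {a b c : ℕ} (ha : Odd a) (hb : Odd b) (hc : Odd c)
    (hab : a.Coprime b) (hac : a.Coprime c) (hbc : b.Coprime c)
    (h1 : J(-(b * c) | a) = 1) (h2 : J(-(2 * a * c) | b) = 1) (h3 : J(-(2 * a * b) | c) = 1) :
    ((b * c : ZMod 8) = 1 ∨ (b * c : ZMod 8) = 7) ↔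
      (2 * (a : ZMod 8) = 2 * b ∧ 2 * (b : ZMod 8) = 2 * c) := by
  have hT := jacobiSym_ternary ha hb hc hab hac hbc
  have e2 : (-(2 * a * c) : ℤ) = 2 * (-(a * c)) := by ring
  have e3 : (-(2 * a * b) : ℤ) = 2 * (-(a * b)) := by ring
  rw [e2, jacobiSym.mul_left, jacobiSym.at_two hb] at h2
  rw [e3, jacobiSym.mul_left, jacobiSym.at_two hc] at h3
  have hχ : ∀ b ∈ ({1, 3, 5, 7} : Finset (ZMod 8)), ∀ c ∈ ({1, 3, 5, 7} : Finset (ZMod 8)),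
      ZMod.χ₈ b * ZMod.χ₈ c = if b * c = 1 ∨ b * c = 7 then 1 else -1 := by decide
  have hbc8 := hχ _ (zmod_eight_of_odd (x := b) (by exact_mod_cast hb)) _
    (zmod_eight_of_odd (x := c) (by exact_mod_cast hc))
  push_cast at hbc8
  have hprod : ZMod.χ₈ b * ZMod.χ₈ c *
      (J(-(b * c) | a) * J(-(a * c) | b) * J(-(a * b) | c)) = 1 := by
    calc _ = J(-(b * c) | a) * (ZMod.χ₈ b * J(-(a * c) | b)) * (ZMod.χ₈ c * J(-(a * b) | c)) := by
          ring
      _ = 1 := by rw [h1, h2, h3]; norm_num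
  rw [hT, hbc8] at hprod
  rw [two_mul_zmod_eight_eq_iff, two_mul_zmod_eight_eq_iff]
  by_cases hA : (b * c : ZMod 8) = 1 ∨ (b * c : ZMod 8) = 7 <;>
    by_cases hB : a % 4 = b % 4 ∧ b % 4 = c % 4 <;> simp [hA, hB] at hprod ⊢

theorem jacobiSym_eq_one_of_forall_prime {K : ℤ} {n : ℕ} (hK : K.gcd n = 1)
    (h : ∀ q : ℕ, q.Prime → q ∣ n → J(K | q) ≠ -1) : J(K | n) = 1 := by
  refine (jacobiSym.eq_one_or_neg_one hK).resolve_right fun hn => ?_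
  obtain ⟨q, hq, hqn, hqJ⟩ := jacobiSym.eq_neg_one_at_prime_divisor_of_eq_neg_one hn
  exact h q hq hqn hqJ

theorem int_gcd_neg_mul_eq_one {a b n : ℕ} (ha : a.Coprime n) (hb : b.Coprime n) :
    Int.gcd (-(a * b : ℤ)) n = 1 := by
  rw [Int.neg_gcd]
  exact_mod_cast Nat.Coprime.mul_left ha hb

/-- The residue class `u` with `a b u ≡ -1` modulo `8`. -/
theorem exists_zmod_eight_inverse {a b : ℕ} (ha : Odd a) (hb : Odd b) :
    ∃ u : ℕ, 1 ≤ u ∧ u ≤ 7 ∧ ∀ g : ZMod 8, g ^ 2 = 1 → g * u = -(g * a * b) := by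
  have ha2 := Nat.odd_iff.1 ha
  have hb2 := Nat.odd_iff.1 hb
  have hodd : (a * b) % 2 = 1 := Nat.odd_iff.1 (ha.mul hb)
  refine ⟨(7 * (a * b)) % 8, by omega, by omega, fun g _ => ?_⟩
  rw [ZMod.natCast_mod]
  push_cast
  have h8 : (8 : ZMod 8) = 0 := by decide
  linear_combination (g * a * b) * h8

/-- Since q divides both g and the target gD, the factor D can be a q-adic unit: it only has to make
the quotient of the two q-divisible terms a non-residue. -/
theorem exists_not_represented_of_dvd_scale {g a b q : ℕ} (hq : q.Prime) (hq2 : q ≠ 2)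
    (hg : Squarefree g) (hqg : q ∣ g) (h : J(-(a * b) | q) = -1) :
    ∃ D : ℕ, 1 ≤ D ∧ D ≤ q * leastNonresidue q ∧
      ∀ x y z w : ℤ, g * x ^ 2 + a * y ^ 2 + b * z ^ 2 = g * D * w ^ 2 → w = 0 := by
  have : Fact q.Prime := ⟨hq⟩
  rw [← jacobiSym.legendreSym.to_jacobiSym] at h
  obtain ⟨c, rfl⟩ := hqg
  have hc : ¬ (q : ℤ) ∣ c * c := by
    rw [(Nat.prime_iff_prime_int.1 hq).dvd_mul, or_self]
    intro h
    obtain ⟨e, rfl⟩ := Int.natCast_dvd_natCast.1 h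
    exact hq.not_isUnit (hg q ⟨e, by ring⟩)
  obtain ⟨u, hu1, hu2, hu⟩ := exists_legendreSym_mul_eq_neg_one hq2 hc
  refine ⟨u, hu1, hu2.trans (Nat.le_mul_of_pos_left _ hq.pos), fun x y z w hxy => ?_⟩
  refine eq_zero_of_legendreSym_eq_neg_one (q := q) (A := c) (B := a) (C := b) (E := c * u) h
    (by rw [← mul_assoc]; exact hu) x y z w ?_
  push_cast at hxy
  linear_combination hxy

/-- Here q does not divide g, so D must itself carry a factor q to match the term in a. This gives D
= qu with u ≤ γ_q. -/
theorem exists_not_represented_of_dvd_coeff {g a b q : ℕ} (hq : q.Prime) (hq2 : q ≠ 2)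
    (ha : Squarefree a) (hqa : q ∣ a) (hga : g.Coprime a) (h : J(-(g * b) | q) = -1) :
    ∃ D : ℕ, 1 ≤ D ∧ D ≤ q * leastNonresidue q ∧
      ∀ x y z w : ℤ, g * x ^ 2 + a * y ^ 2 + b * z ^ 2 = g * D * w ^ 2 → w = 0 := by
  have : Fact q.Prime := ⟨hq⟩
  rw [← jacobiSym.legendreSym.to_jacobiSym] at h
  have hqg : ¬ q ∣ g := fun hg => hq.not_dvd_one (hga ▸ Nat.dvd_gcd hg hqa)
  obtain ⟨c, rfl⟩ := hqa
  have hc : ¬ (q : ℤ) ∣ c * g := by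
    rw [(Nat.prime_iff_prime_int.1 hq).dvd_mul, not_or]
    refine ⟨fun h => ?_, fun h => hqg (Int.natCast_dvd_natCast.1 h)⟩
    obtain ⟨e, rfl⟩ := Int.natCast_dvd_natCast.1 h
    exact hq.not_isUnit (ha q ⟨e, by ring⟩)
  obtain ⟨u, hu1, hu2, hu⟩ := exists_legendreSym_mul_eq_neg_one hq2 hc
  refine ⟨q * u, Nat.mul_pos hq.pos hu1, Nat.mul_le_mul_left _ hu2, fun x y z w hxy => ?_⟩
  refine eq_zero_of_legendreSym_eq_neg_one (q := q) (A := c) (B := g) (C := b) (E := g * u) h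
    (by rw [← mul_assoc]; exact hu) y x z w ?_
  push_cast at hxy
  linear_combination hxy

theorem odd_of_squarefree_two_mul {a : ℕ} (h : Squarefree (2 * a)) : Odd a := by
  rw [← Nat.not_even_iff_odd]
  rintro ⟨k, rfl⟩
  exact absurd (h 2 ⟨k, by ring⟩) (by decide)

/-- The target must be even to match the coefficient 2a, so D = 2u with u ≤ 7; this explains 14 =
2γ_2. -/
theorem exists_not_represented_of_even_coeff {g a b : ℕ} (hg : Odd g) (ha : Odd a) (hb : Odd b)
    (hga : g.Coprime a) (hgb : g.Coprime b) (hab : a.Coprime b)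
    (h1 : J(-(2 * a * b) | g) = 1) (h2 : J(-(g * b) | a) = 1) (h3 : J(-(2 * a * g) | b) = 1) :
    ∃ D : ℕ, 1 ≤ D ∧ D ≤ 14 ∧ ∀ x y z w : ℤ,
      g * x ^ 2 + (2 * a : ℕ) * y ^ 2 + b * z ^ 2 = g * D * w ^ 2 → w = 0 := by
  obtain ⟨u, hu1, hu7, hu⟩ := exists_zmod_eight_inverse ha hb
  refine ⟨2 * u, by omega, by omega, fun x y z w h => ?_⟩
  have hg8 := zmod_eight_sq_of_odd (x := g) (by exact_mod_cast hg)
  push_cast at hg8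
  have hcond := zmod_eight_condition_of_jacobiSym ha hg hb hga.symm hab hgb h2 h1 h3
  refine eq_zero_of_even_two_adic (a := a) (b := g) (c := b) (e := g * u)
    (by exact_mod_cast ha) (by exact_mod_cast hg) (by exact_mod_cast hb)
    (by push_cast; exact hcond) (by push_cast; rw [hu _ hg8]; ring) y x z w ?_
  push_cast at h
  linear_combination h

/-- If a Legendre condition fails at an odd prime, the form is anisotropic there and misses a class.
If all of them hold, reciprocity forces anisotropy at 2. Coprimality leaves at most one even
coefficient, which gives the cases. -/
theorem exists_not_represented_of_coprime {g a b : ℕ} (hg : Squarefree g) (ha : Squarefree a)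
    (hb : Squarefree b) (hga : g.Coprime a) (hgb : g.Coprime b) (hab : a.Coprime b) :
    ∃ q D : ℕ, q.Prime ∧ (q = 2 ∨ q ∣ g * a ∨ q ∣ g * b) ∧ 1 ≤ D ∧ D ≤ q * leastNonresidue q ∧
      ∀ x y z w : ℤ, g * x ^ 2 + a * y ^ 2 + b * z ^ 2 = g * D * w ^ 2 → w = 0 := by
  by_cases h1 : ∃ q : ℕ, q.Prime ∧ q ≠ 2 ∧ q ∣ g ∧ J(-(a * b) | q) = -1
  · obtain ⟨q, hq, hq2, hqg, h⟩ := h1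
    obtain ⟨D, hD⟩ := exists_not_represented_of_dvd_scale hq hq2 hg hqg h
    exact ⟨q, D, hq, Or.inr (Or.inl (hqg.mul_right _)), hD⟩
  by_cases h2 : ∃ q : ℕ, q.Prime ∧ q ≠ 2 ∧ q ∣ a ∧ J(-(g * b) | q) = -1
  · obtain ⟨q, hq, hq2, hqa, h⟩ := h2
    obtain ⟨D, hD⟩ := exists_not_represented_of_dvd_coeff hq hq2 ha hqa hga h
    exact ⟨q, D, hq, Or.inr (Or.inl (hqa.mul_left _)), hD⟩
  by_cases h3 : ∃ q : ℕ, q.Prime ∧ q ≠ 2 ∧ q ∣ b ∧ J(-(g * a) | q) = -1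
  · obtain ⟨q, hq, hq2, hqb, h⟩ := h3
    obtain ⟨D, hD1, hD2, hD⟩ := exists_not_represented_of_dvd_coeff hq hq2 hb hqb hgb h
    exact ⟨q, D, hq, Or.inr (Or.inr (hqb.mul_left _)), hD1, hD2, fun x y z w h =>
      hD x z y w (by linear_combination h)⟩
  -- Without an obstruction at odd primes, every prime factor contributes +1 to the Jacobi symbol; n
  -- is the odd part of a coefficient e.
  have key : ∀ {n c d e : ℕ}, Odd n → n ∣ e → c.Coprime e → d.Coprime e →
      (¬ ∃ q : ℕ, q.Prime ∧ q ≠ 2 ∧ q ∣ e ∧ J(-(c * d) | q) = -1) → J(-(c * d) | n) = 1 := by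
    intro n c d e hn hne hc hd hno
    refine jacobiSym_eq_one_of_forall_prime (int_gcd_neg_mul_eq_one (hc.coprime_dvd_right hne)
      (hd.coprime_dvd_right hne)) fun q hq hqn hJ => hno ⟨q, hq, ?_, hqn.trans hne, hJ⟩
    rintro rfl
    exact Nat.not_even_iff_odd.2 hn (even_iff_two_dvd.2 hqn)
  have hno2 : ∀ {c d : ℕ}, c.Coprime d → Even c → Odd d := fun {c d} h hc => by
    rw [← Nat.not_even_iff_odd]
    intro hd
    exact absurd (h ▸ Nat.dvd_gcd (even_iff_two_dvd.1 hc) (even_iff_two_dvd.1 hd)) (by decide)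
  have hγ : leastNonresidue 2 = 7 := by simp [leastNonresidue]
  rcases Nat.even_or_odd a with hae | hao
  · have hgo := hno2 hga.symm hae
    have hbo := hno2 hab hae
    obtain ⟨a', rfl⟩ := even_iff_two_dvd.1 hae
    have hao := odd_of_squarefree_two_mul ha
    obtain ⟨D, hD1, hD2, hD⟩ := exists_not_represented_of_even_coeff hgo hao hbo
      hga.coprime_mul_left_right hgb hab.coprime_mul_left
      (by exact_mod_cast key hgo dvd_rfl hga.symm hgb.symm h1)
      (by exact_mod_cast key hao (dvd_mul_left _ _) hga hab.symm h2)
      (by rw [mul_comm (2 * (a' : ℤ))]; exact_mod_cast key hbo dvd_rfl hgb hab h3)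
    exact ⟨2, D, Nat.prime_two, Or.inl rfl, hD1, by rw [hγ]; exact hD2, hD⟩
  rcases Nat.even_or_odd b with hbe | hbo
  · have hgo := hno2 hgb.symm hbe
    obtain ⟨b', rfl⟩ := even_iff_two_dvd.1 hbe
    have hbo := odd_of_squarefree_two_mul hb
    obtain ⟨D, hD1, hD2, hD⟩ := exists_not_represented_of_even_coeff hgo hbo hao
      hgb.coprime_mul_left_right hga hab.symm.coprime_mul_left
      (by rw [mul_comm (2 * (b' : ℤ))]; exact_mod_cast key hgo dvd_rfl hga.symm hgb.symm h1)
      (by exact_mod_cast key hbo (dvd_mul_left _ _) hgb hab h3)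
      (by rw [mul_comm (2 * (b' : ℤ))]; exact_mod_cast key hao dvd_rfl hga hab.symm h2)
    exact ⟨2, D, Nat.prime_two, Or.inl rfl, hD1, by rw [hγ]; exact hD2, fun x y z w h =>
      hD x z y w (by linear_combination h)⟩
  -- With a and b odd, D = u is the unit class of −ab modulo 8, whatever the parity of g; a factor 2
  -- in g occurs on both sides.
  obtain ⟨u, hu1, hu7, hu⟩ := exists_zmod_eight_inverse hao hbo
  refine ⟨2, u, Nat.prime_two, Or.inl rfl, hu1, by rw [hγ]; omega, fun x y z w h => ?_⟩
  rcases Nat.even_or_odd g with hge | hgo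
  · obtain ⟨g', rfl⟩ := even_iff_two_dvd.1 hge
    have hgo := odd_of_squarefree_two_mul hg
    have hg8 := zmod_eight_sq_of_odd (x := g') (by exact_mod_cast hgo)
    push_cast at hg8
    have hcond := zmod_eight_condition_of_jacobiSym hgo hao hbo
      hga.coprime_mul_left hgb.coprime_mul_left hab
      (by exact_mod_cast key hgo (dvd_mul_left _ _) hga.symm hgb.symm h1)
      (by exact_mod_cast key hao dvd_rfl hga hab.symm h2)
      (by exact_mod_cast key hbo dvd_rfl hgb hab h3)
    refine eq_zero_of_even_two_adic (a := g') (b := a) (c := b) (e := g' * u)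
      (by exact_mod_cast hgo) (by exact_mod_cast hao) (by exact_mod_cast hbo)
      (by push_cast; exact hcond) (by push_cast; rw [hu _ hg8]) x y z w ?_
    push_cast at h
    linear_combination h
  · have hg8 := zmod_eight_sq_of_odd (x := g) (by exact_mod_cast hgo)
    push_cast at hg8
    have hT := jacobiSym_ternary hgo hao hbo hga hgb hab
    rw [key hgo dvd_rfl hga.symm hgb.symm h1, key hao dvd_rfl hga hab.symm h2,
      key hbo dvd_rfl hgb hab h3] at hT
    have hmod : g % 4 = a % 4 ∧ a % 4 = b % 4 := by
      by_contra hne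
      rw [if_neg hne] at hT
      norm_num at hT
    refine eq_zero_of_odd_two_adic (a := g) (b := a) (c := b) (e := g * u)
      (by exact_mod_cast hgo) (by exact_mod_cast hao) (by exact_mod_cast hbo)
      (by push_cast; exact (two_mul_zmod_eight_eq_iff _ _).2 hmod.1)
      (by push_cast; exact (two_mul_zmod_eight_eq_iff _ _).2 hmod.2)
      (by push_cast; rw [hu _ hg8]) x y z w h

/-- A positive ternary form `x² + a y² + b z²` does not represent some small integer over `ℚ`. -/
theorem exists_not_represented_ternary (a b : ℕ) :
    ∃ q D : ℕ, q.Prime ∧ (q = 2 ∨ q ∣ a ∨ q ∣ b) ∧ 1 ≤ D ∧ D ≤ q * leastNonresidue q ∧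
      ∀ x y z w : ℤ, x ^ 2 + a * y ^ 2 + b * z ^ 2 = D * w ^ 2 → w = 0 := by
  obtain ⟨a₀, s, hsa, hsqa⟩ := Nat.sq_mul_squarefree a
  obtain ⟨b₀, t, htb, hsqb⟩ := Nat.sq_mul_squarefree b
  have hg0 : 0 < a₀.gcd b₀ := Nat.gcd_pos_of_pos_left _ (Nat.pos_of_ne_zero hsqa.ne_zero)
  -- Multiplying the equation by g = gcd(a₀, b₀) turns ga = gs²a₁g into a₁(gs)², and similarly for
  -- b. The coefficients become g, a₁, b₁, squarefree and pairwise coprime, with target gD.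
  obtain ⟨a₁, b₁, hcop, ha₁, hb₁⟩ := Nat.exists_coprime a₀ b₀
  set g := a₀.gcd b₀ with hgdef
  have hga := Nat.squarefree_mul_iff.1 (ha₁ ▸ hsqa)
  have hgb := Nat.squarefree_mul_iff.1 (hb₁ ▸ hsqb)
  obtain ⟨q, D, hq, hqd, hD1, hD2, hD⟩ := exists_not_represented_of_coprime hga.2.2 hga.2.1
    hgb.2.1 hga.1.symm hgb.1.symm hcop
  have hda : g * a₁ ∣ a := by
    rw [← hsa, ha₁, mul_comm g]; exact dvd_mul_left _ _
  have hdb : g * b₁ ∣ b := by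
    rw [← htb, hb₁, mul_comm g]; exact dvd_mul_left _ _
  refine ⟨q, D, hq, ?_, hD1, hD2, fun x y z w h => ?_⟩
  · rcases hqd with h | h | h
    · exact Or.inl h
    · exact Or.inr (Or.inl (h.trans hda))
    · exact Or.inr (Or.inr (h.trans hdb))
  · refine hD x (g * s * y) (g * t * z) w ?_
    have hA : (a : ℤ) = s ^ 2 * (a₁ * g) := by rw [← hsa, ha₁]; push_cast; ring
    have hB : (b : ℤ) = t ^ 2 * (b₁ * g) := by rw [← htb, hb₁]; push_cast; ring
    rw [hA, hB] at h
    linear_combination (g : ℤ) * h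

end

/-! ### Integral Gram matrices -/

section

open Matrix

theorem det_quaternary {R : Type*} [CommRing R] (a b c d e f g h i j : R) :
    det !![a, b, c, d; b, e, f, g; c, f, h, i; d, g, i, j] =
      j * (a * e * h + 2 * b * c * f - a * f ^ 2 - e * c ^ 2 - h * b ^ 2)
      - (d ^ 2 * (e * h - f ^ 2) + g ^ 2 * (a * h - c ^ 2) + i ^ 2 * (a * e - b ^ 2)
        + 2 * d * g * (c * f - b * h) + 2 * d * i * (b * f - c * e)
        + 2 * g * i * (b * c - a * f)) := by
  simp [det_succ_row_zero, Fin.sum_univ_succ, Fin.succAbove]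
  ring

theorem det_ternary {R : Type*} [CommRing R] (a b c e f h : R) :
    det !![a, b, c; b, e, f; c, f, h] =
      a * e * h + 2 * b * c * f - a * f ^ 2 - e * c ^ 2 - h * b ^ 2 := by
  rw [det_fin_three]
  simp
  ring

/-- There is a small `C` such that no integral extension of the binary form with Gram matrix
`(m, b; b, 2m)` by a vector of norm `C m` is degenerate. -/
theorem exists_nondegenerate_ternary {m : ℕ} (hm : 0 < m) (b : ℤ) :
    ∃ p C : ℕ, (p.Prime ∧ p ≤ 2 * m ^ 2) ∧ (2 ≤ C ∧ C ≤ leastNonresidue p) ∧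
      (b ^ 2 < 2 * m ^ 2 → ∀ c e : ℤ,
        det !![(m : ℤ), b, c; b, 2 * m, e; c, e, C * m] ≠ 0) := by
  have hm2 : 1 ≤ m ^ 2 := Nat.one_le_pow _ _ hm
  by_cases hb : b ^ 2 < 2 * m ^ 2
  · obtain ⟨d, hd⟩ := Int.eq_ofNat_of_zero_le (a := 2 * m ^ 2 - b ^ 2) (by omega)
    have hd0 : 0 < d := by zify; omega
    obtain ⟨p, C, hp, hpd, hC2, hC, hno⟩ := exists_not_represented_binary d hd0
    have hdm : d ≤ 2 * m ^ 2 := by zify; nlinarith [sq_nonneg b]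
    refine ⟨p, C, ⟨hp, hpd.trans (max_le (by omega) hdm)⟩, ⟨hC2, hC⟩, fun _ c e hdet => ?_⟩
    rw [det_ternary] at hdet
    -- Completing the square gives m·det = d(Cm² − c²) − (me − bc)², so det = 0 yields (cd)² + d(me
    -- − bc)² = C(md)².
    have h0 := hno (c * d) (m * e - b * c) (m * d) ?_
    · have : (m : ℤ) * d ≠ 0 := by positivity
      exact this h0
    · rw [← hd]
      linear_combination (-(m : ℤ) * (2 * m ^ 2 - b ^ 2)) * hdet
  -- Default values: if b² ≥ 2m², the nondegeneracy claim is empty.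
  · exact ⟨2, 2, ⟨Nat.prime_two, by omega⟩, ⟨le_rfl, by simp [leastNonresidue]⟩,
      fun h => absurd h hb⟩

/-- The same completed square bounds m·det by a product of two 2×2 minors. This is what keeps the
prime q, a possible divisor of the determinant, below 2Cm³. -/
theorem det_ternary_le {m C b c e : ℤ} (hm : 0 < m) (hb : b ^ 2 < 2 * m ^ 2)
    (hdet : 0 < det !![m, b, c; b, 2 * m, e; c, e, C * m]) :
    det !![m, b, c; b, 2 * m, e; c, e, C * m] ≤ 2 * C * m ^ 3 := by
  have key : m * det !![m, b, c; b, 2 * m, e; c, e, C * m] =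
      (2 * m ^ 2 - b ^ 2) * (C * m ^ 2 - c ^ 2) - (m * e - b * c) ^ 2 := by
    rw [det_ternary]; ring
  have h1 : 0 < (2 * m ^ 2 - b ^ 2) * (C * m ^ 2 - c ^ 2) := by
    nlinarith [mul_pos hm hdet, sq_nonneg (m * e - b * c)]
  have h2 : 0 < C * m ^ 2 - c ^ 2 := pos_of_mul_pos_right h1 (by linarith)
  have h3 : (2 * m ^ 2 - b ^ 2) * (C * m ^ 2 - c ^ 2) ≤ 2 * m ^ 2 * (C * m ^ 2) :=
    mul_le_mul (by nlinarith [sq_nonneg b]) (by nlinarith [sq_nonneg c]) h2.le (by positivity)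
  have h4 : m * det !![m, b, c; b, 2 * m, e; c, e, C * m] ≤ m * (2 * C * m ^ 3) := by
    nlinarith [sq_nonneg (m * e - b * c)]
  exact le_of_mul_le_mul_left h4 hm

/-- There is a small `D` such that no integral extension of a positive definite ternary form
by a vector of norm `D m` is degenerate. -/
theorem exists_nondegenerate_quaternary {m C : ℕ} (hm : 0 < m) (hC : 0 < C) (b c e : ℤ) :
    ∃ q D : ℕ, (q.Prime ∧ q ≤ 2 * C * m ^ 3) ∧ (1 ≤ D ∧ D ≤ q * leastNonresidue q) ∧
      (b ^ 2 < 2 * m ^ 2 → 0 < det !![(m : ℤ), b, c; b, 2 * m, e; c, e, C * m] →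
        ∀ f g h : ℤ, det !![(m : ℤ), b, c, f; b, 2 * m, e, g; c, e, C * m, h; f, g, h, D * m]
          ≠ 0) := by
  have hm2 : 1 ≤ C * m ^ 3 := Nat.one_le_iff_ne_zero.2 (by positivity)
  by_cases hb : b ^ 2 < 2 * m ^ 2 ∧ 0 < det !![(m : ℤ), b, c; b, 2 * m, e; c, e, C * m]
  · obtain ⟨hb, hdet⟩ := hb
    obtain ⟨d₂, hd₂⟩ := Int.eq_ofNat_of_zero_le (a := 2 * m ^ 2 - b ^ 2) (by omega)
    obtain ⟨d₃, hd₃⟩ := Int.eq_ofNat_of_zero_le hdet.le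
    have hd₂0 : 0 < d₂ := by zify; omega
    have hd₃0 : 0 < d₃ := by zify; omega
    have hd₃le : d₃ ≤ 2 * C * m ^ 3 := by
      zify
      rw [← hd₃]
      exact det_ternary_le (by exact_mod_cast hm) hb hdet
    have hd₂le : d₂ ≤ 2 * C * m ^ 3 := by
      have h1 : d₂ ≤ 2 * m ^ 2 := by zify; nlinarith [sq_nonneg b]
      have h2 : m ^ 2 ≤ C * m ^ 3 := by
        calc m ^ 2 ≤ m ^ 2 * (C * m) := Nat.le_mul_of_pos_right _ (by positivity)
          _ = C * m ^ 3 := by ring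
      nlinarith
    have hmle : m ≤ 2 * C * m ^ 3 := by
      calc m ≤ m * (2 * C * m ^ 2) := Nat.le_mul_of_pos_right _ (by positivity)
        _ = 2 * C * m ^ 3 := by ring
    -- Gram–Schmidt diagonalises the ternary form as ⟨m, d₂/m, d₃/d₂⟩. Dividing by m and dropping
    -- squares leaves ⟨1, d₂, m d₂ d₃⟩, whose value D corresponds to norm Dm.
    obtain ⟨q, D, hq, hqd, hD1, hD2, hno⟩ := exists_not_represented_ternary d₂ (m * d₂ * d₃)
    refine ⟨q, D, ⟨hq, ?_⟩, ⟨hD1, hD2⟩, fun _ _ f g h hd => ?_⟩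
    · have hcases : q = 2 ∨ q ∣ d₂ ∨ q ∣ m ∨ q ∣ d₃ := by
        rw [hq.dvd_mul, hq.dvd_mul] at hqd
        tauto
      rcases hcases with h | h | h | h
      · rw [h, mul_assoc]; omega
      · exact (Nat.le_of_dvd hd₂0 h).trans hd₂le
      · exact (Nat.le_of_dvd hm h).trans hmle
      · exact (Nat.le_of_dvd hd₃0 h).trans hd₃le
    · rw [det_quaternary] at hd
      rw [det_ternary] at hd₃
      -- These are the Gram–Schmidt coordinates of the fourth vector over the common denominator m
      -- d₂ d₃; a vanishing determinant puts that vector in the span of the other three.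
      have h0 := hno (f * d₂ * d₃) ((m * g - b * f) * d₃)
        (f * (b * e - 2 * m * c) + g * (b * c - m * e) + h * (2 * m ^ 2 - b ^ 2))
        (m * d₂ * d₃) ?_
      · have : (m : ℤ) * d₂ * d₃ ≠ 0 := by positivity
        exact this h0
      · push_cast
        rw [← hd₃, ← hd₂]
        linear_combination (-(m : ℤ) * (2 * m ^ 2 - b ^ 2) ^ 2 * (m * (2 * m) * (C * m) +
          2 * b * c * e - m * e ^ 2 - 2 * m * c ^ 2 - C * m * b ^ 2)) * hd
  · refine ⟨2, 1, ⟨Nat.prime_two, by rw [mul_assoc]; omega⟩,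
      ⟨le_rfl, by simp [leastNonresidue]⟩, fun h1 h2 => absurd ⟨h1, h2⟩ hb⟩

end

/-! ### Nearly positive semidefinite real matrices -/

section

open Matrix

theorem posSemidef_sq_le {n : Type*} {M : Matrix n n ℝ} (hM : M.PosSemidef) (i j : n) :
    M i j ^ 2 ≤ M i i * M j j := by
  have h := (hM.submatrix ![i, j]).det_nonneg
  rw [det_fin_two] at h
  simp only [submatrix_apply, cons_val_zero, cons_val_one] at h
  have hs : M j i = M i j := by simpa using hM.isHermitian.apply i j
  rw [hs] at h
  linarith [sq (M i j)]

theorem posSemidef_diag_nonneg {n : Type*} {M : Matrix n n ℝ} (hM : M.PosSemidef) (i : n) :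
    0 ≤ M i i := by
  have h := (hM.submatrix fun _ : Fin 1 => i).det_nonneg
  rwa [det_unique] at h

/-- Hadamard's inequality for ternary forms. -/
theorem ternary_det_le_prod {a b c f g h : ℝ} (ha : 0 ≤ a) (hb : 0 ≤ b)
    (hh : h ^ 2 ≤ a * b) :
    a * b * c + 2 * f * g * h - a * f ^ 2 - b * g ^ 2 - c * h ^ 2 ≤ a * b * c - c * h ^ 2 := by
  have h1 : |h| ≤ √a * √b := by
    rw [← Real.sqrt_mul ha]
    exact Real.abs_le_sqrt hh
  have h2 : f * g * h ≤ |f| * |g| * (√a * √b) := by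
    calc f * g * h ≤ |f * g * h| := le_abs_self _
      _ = |f| * |g| * |h| := by rw [abs_mul, abs_mul]
      _ ≤ _ := mul_le_mul_of_nonneg_left h1 (by positivity)
  have h3 : a * f ^ 2 = (√a * |f|) ^ 2 := by rw [mul_pow, Real.sq_sqrt ha, sq_abs]
  have h4 : b * g ^ 2 = (√b * |g|) ^ 2 := by rw [mul_pow, Real.sq_sqrt hb, sq_abs]
  nlinarith [sq_nonneg (√a * |f| - √b * |g|)]

theorem posSemidef_minor_le {n : Type*} {M : Matrix n n ℝ} (hM : M.PosSemidef) (i j k : n) :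
    M i i * M j j * M k k + 2 * M i j * M i k * M j k - M i i * M j k ^ 2 - M j j * M i k ^ 2
      - M k k * M i j ^ 2 ≤ M i i * M j j * M k k := by
  have := ternary_det_le_prod (c := M k k) (f := M j k) (g := M i k)
    (posSemidef_diag_nonneg hM i) (posSemidef_diag_nonneg hM j) (posSemidef_sq_le hM i j)
  have h2 := mul_nonneg (posSemidef_diag_nonneg hM k) (sq_nonneg (M i j))
  linarith

/-- If `N + δ` is positive semidefinite, then `det N` is not much below zero. -/
theorem neg_det_ternary_le {a b c e f h δ : ℝ} (hδ : 0 ≤ δ)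
    (hM : (!![a, b, c; b, e, f; c, f, h] + δ • (1 : Matrix (Fin 3) (Fin 3) ℝ)).PosSemidef) :
    -det !![a, b, c; b, e, f; c, f, h] ≤
      δ * ((a + δ) * (e + δ) + (a + δ) * (h + δ) + (e + δ) * (h + δ)) + δ ^ 3 := by
  -- With P = N + δ one has det N = det P − δe₂(P) + δ²e₁(P) − δ³, where e₂(P) is at most the sum of
  -- the products of pairs of diagonal entries.
  have hdet := hM.det_nonneg
  have hform : !![a, b, c; b, e, f; c, f, h] + δ • (1 : Matrix (Fin 3) (Fin 3) ℝ) =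
      !![a + δ, b, c; b, e + δ, f; c, f, h + δ] := by
    ext i j
    fin_cases i <;> fin_cases j <;> simp
  rw [hform] at hdet hM
  rw [det_ternary] at hdet ⊢
  have d0 := posSemidef_diag_nonneg hM 0
  have d1 := posSemidef_diag_nonneg hM 1
  have d2 := posSemidef_diag_nonneg hM 2
  simp at d0 d1 d2
  have h1 : 0 ≤ δ * (b ^ 2 + c ^ 2 + f ^ 2) := by positivity
  have h2 : 0 ≤ δ ^ 2 * ((a + δ) + (e + δ) + (h + δ)) := by positivity
  nlinarith

/-- With P = N + δ, det N = det P − δe₃(P) + δ²e₂(P) − δ³e₁(P) + δ⁴. The terms in det P, e₂ and δ⁴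
are nonnegative, and Hadamard's inequality bounds the 3×3 minors in e₃. -/
theorem neg_det_quaternary_le {a b c d e f g h i j δ : ℝ} (hδ : 0 ≤ δ)
    (hM : (!![a, b, c, d; b, e, f, g; c, f, h, i; d, g, i, j] +
      δ • (1 : Matrix (Fin 4) (Fin 4) ℝ)).PosSemidef) :
    -det !![a, b, c, d; b, e, f, g; c, f, h, i; d, g, i, j] ≤
      δ * ((a + δ) * (e + δ) * (h + δ) + (a + δ) * (e + δ) * (j + δ) +
        (a + δ) * (h + δ) * (j + δ) + (e + δ) * (h + δ) * (j + δ)) +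
      δ ^ 3 * ((a + δ) + (e + δ) + (h + δ) + (j + δ)) := by
  have hdet := hM.det_nonneg
  have hform : !![a, b, c, d; b, e, f, g; c, f, h, i; d, g, i, j] +
      δ • (1 : Matrix (Fin 4) (Fin 4) ℝ) =
      !![a + δ, b, c, d; b, e + δ, f, g; c, f, h + δ, i; d, g, i, j + δ] := by
    ext i j
    fin_cases i <;> fin_cases j <;> simp
  rw [hform] at hdet hM
  rw [det_quaternary] at hdet ⊢
  have m1 := posSemidef_minor_le hM 0 1 2
  have m2 := posSemidef_minor_le hM 0 1 3
  have m3 := posSemidef_minor_le hM 0 2 3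
  have m4 := posSemidef_minor_le hM 1 2 3
  have q1 := posSemidef_sq_le hM 0 1
  have q2 := posSemidef_sq_le hM 0 2
  have q3 := posSemidef_sq_le hM 0 3
  have q4 := posSemidef_sq_le hM 1 2
  have q5 := posSemidef_sq_le hM 1 3
  have q6 := posSemidef_sq_le hM 2 3
  simp at m1 m2 m3 m4 q1 q2 q3 q4 q5 q6
  have hm := mul_le_mul_of_nonneg_left (add_le_add (add_le_add m1 m2) (add_le_add m3 m4)) hδ
  have hq := mul_le_mul_of_nonneg_left (add_le_add (add_le_add (add_le_add q1 q2) q3)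
    (add_le_add (add_le_add q4 q5) q6)) (sq_nonneg δ)
  have h4 : 0 ≤ δ ^ 4 := by positivity
  linarith

/-- One step of Sylvester's criterion. -/
theorem posDef_of_det_pos {n : ℕ} {M : Matrix (Fin (n + 1)) (Fin (n + 1)) ℝ}
    (hM : M.IsHermitian) (hA : (M.submatrix Fin.castSucc Fin.castSucc).PosDef)
    (hdet : 0 < M.det) : M.PosDef := by
  set A := M.submatrix Fin.castSucc Fin.castSucc with hAdef
  set e : Fin n ⊕ Fin 1 ≃ Fin (n + 1) := finSumFinEquiv with he
  set B : Matrix (Fin n) (Fin 1) ℝ := M.submatrix Fin.castSucc (fun _ => Fin.last n) with hB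
  set D : Matrix (Fin 1) (Fin 1) ℝ := M.submatrix (fun _ => Fin.last n) (fun _ => Fin.last n)
    with hD
  have hinl : ∀ i : Fin n, e (Sum.inl i) = Fin.castSucc i := fun i => rfl
  have hinr : ∀ i : Fin 1, e (Sum.inr i) = Fin.last n := fun i => by
    rw [Subsingleton.elim i 0]; rfl
  have hblocks : M.submatrix e e = fromBlocks A B Bᴴ D := by
    ext i j
    rcases i with i | i <;> rcases j with j | j
    · simp [hinl, hAdef]
    · simp [hinl, hinr, hB]
    · simpa [hinl, hinr, hB] using hM.apply (Fin.last n) j.castSucc |>.symm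
    · simp [hinr, hD]
  have hdetA := hA.det_pos
  have hAunit : IsUnit A := hA.isUnit
  let := hAunit.invertible
  have hdet2 : M.det = A.det * (D - Bᴴ * A⁻¹ * B).det := by
    rw [← det_submatrix_equiv_self e M, hblocks, det_fromBlocks₁₁, invOf_eq_nonsing_inv]
  -- The Schur complement is 1×1, so its sign is read off from det M / det A.
  have hS : 0 < (D - Bᴴ * A⁻¹ * B) 0 0 := by
    rw [hdet2, det_unique (D - _)] at hdet
    exact pos_of_mul_pos_right hdet hdetA.le
  have hSpsd : (D - Bᴴ * A⁻¹ * B).PosSemidef := by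
    have : D - Bᴴ * A⁻¹ * B = diagonal (fun _ => (D - Bᴴ * A⁻¹ * B) 0 0) := by
      ext i j
      rw [Subsingleton.elim i 0, Subsingleton.elim j 0, diagonal_apply_eq]
    rw [this]
    exact PosSemidef.diagonal fun _ => hS.le
  have hpsd := (PosDef.fromBlocks₁₁ B D hA).2 hSpsd
  rw [← hblocks, posSemidef_submatrix_equiv] at hpsd
  exact hpsd.posDef_iff_det_ne_zero.2 hdet.ne'

end

/-! ### Real quadratic fields -/

section

open Polynomial

theorem irrational_sqrt_of_squarefree {D : ℕ} (hD : D ≠ 1) (hsq : Squarefree D) :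
    Irrational √(D : ℝ) := by
  rw [irrational_sqrt_natCast_iff]
  rintro ⟨k, rfl⟩
  have := Nat.isUnit_iff.1 (hsq k dvd_rfl)
  subst this
  exact hD rfl

/-- The generator `√D` of `ℚ(√D)`. -/
noncomputable def quadGen (D : ℕ) : RealQuadField D := IntermediateField.AdjoinSimple.gen ℚ (√(D : ℝ))

theorem coe_quadGen (D : ℕ) : (quadGen D : ℝ) = √(D : ℝ) := rfl

theorem quadGen_sq (D : ℕ) : quadGen D ^ 2 = D := by
  apply Subtype.coe_injective
  push_cast
  rw [coe_quadGen, Real.sq_sqrt (Nat.cast_nonneg D)]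

theorem isIntegral_sqrt_natCast (D : ℕ) : IsIntegral ℚ √(D : ℝ) := by
  refine ⟨X ^ 2 - C (D : ℚ), monic_X_pow_sub_C _ two_ne_zero, ?_⟩
  rw [eval₂_sub, eval₂_pow, eval₂_X, eval₂_C, Real.sq_sqrt (Nat.cast_nonneg D)]
  simp

theorem exists_rat_coords {D : ℕ} (x : RealQuadField D) :
    ∃ p q : ℚ, x = p + q * quadGen D := by
  obtain ⟨x, hx⟩ := x
  have hx' : x ∈ Algebra.adjoin ℚ {√(D : ℝ)} := by
    rw [← IntermediateField.adjoin_simple_toSubalgebra_of_isAlgebraic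
      (isIntegral_sqrt_natCast D).isAlgebraic]
    exact hx
  suffices ∃ p q : ℚ, x = p + q * √(D : ℝ) by
    obtain ⟨p, q, h⟩ := this
    refine ⟨p, q, Subtype.coe_injective ?_⟩
    push_cast
    exact h
  clear hx
  induction hx' using Algebra.adjoin_induction with
  | mem x hx =>
    rw [Set.mem_singleton_iff] at hx
    exact ⟨0, 1, by simp [hx]⟩
  | algebraMap r => exact ⟨r, 0, by simp⟩
  | add x y _ _ hx hy =>
    obtain ⟨p, q, rfl⟩ := hx
    obtain ⟨p', q', rfl⟩ := hy
    exact ⟨p + p', q + q', by push_cast; ring⟩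
  | mul x y _ _ hx hy =>
    obtain ⟨p, q, rfl⟩ := hx
    obtain ⟨p', q', rfl⟩ := hy
    refine ⟨p * p' + q * q' * D, p * q' + q * p', ?_⟩
    have := Real.sq_sqrt (Nat.cast_nonneg (α := ℝ) D)
    push_cast
    linear_combination (q * q' : ℝ) * this

theorem minpoly_sqrt {D : ℕ} (h : Irrational √(D : ℝ)) :
    minpoly ℚ √(D : ℝ) = X ^ 2 - C (D : ℚ) := by
  symm
  refine minpoly.eq_of_irreducible_of_monic ?_ ?_ (monic_X_pow_sub_C _ two_ne_zero)
  · rw [irreducible_iff_roots_eq_zero_of_degree_le_three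
      (by rw [natDegree_X_pow_sub_C]) (by rw [natDegree_X_pow_sub_C]; norm_num)]
    refine Multiset.eq_zero_of_forall_notMem fun r hr => ?_
    have hr2 : r ^ 2 = D := by
      have := isRoot_of_mem_roots hr
      simpa [sub_eq_zero] using this
    rw [irrational_sqrt_natCast_iff] at h
    have : IsSquare ((D : ℕ) : ℚ) := ⟨r, by rw [← sq, hr2]⟩
    exact h (Rat.isSquare_natCast_iff.1 this)
  · simp [Real.sq_sqrt (Nat.cast_nonneg (α := ℝ) D)]

theorem exists_quadConj {D : ℕ} (h : Irrational √(D : ℝ)) :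
    ∃ τ : RealQuadField D →+* ℝ, τ (quadGen D) = -√(D : ℝ) := by
  let pb := IntermediateField.adjoin.powerBasis (isIntegral_sqrt_natCast D)
  have hgen : pb.gen = quadGen D := IntermediateField.adjoin.powerBasis_gen _
  have hmin : minpoly ℚ pb.gen = X ^ 2 - C (D : ℚ) := by
    rw [hgen]
    exact (IntermediateField.minpoly_gen ℚ √(D : ℝ)).trans (minpoly_sqrt h)
  have hroot : aeval (-√(D : ℝ)) (minpoly ℚ pb.gen) = 0 := by
    rw [hmin]
    simp [Real.sq_sqrt (Nat.cast_nonneg (α := ℝ) D)]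
  exact ⟨(pb.lift _ hroot).toRingHom, by rw [← hgen]; exact pb.lift_gen _ hroot⟩

theorem ringHom_quad_eq {D : ℕ} {σ τ : RealQuadField D →+* ℝ} (h : σ (quadGen D) = τ (quadGen D)) :
    σ = τ := by
  ext x
  obtain ⟨p, q, rfl⟩ := exists_rat_coords x
  simp [h]

theorem ringHom_quadGen {D : ℕ} (σ : RealQuadField D →+* ℝ) :
    σ (quadGen D) = √(D : ℝ) ∨ σ (quadGen D) = -√(D : ℝ) := by
  rw [← sq_eq_sq_iff_eq_or_eq_neg, ← map_pow, quadGen_sq, map_natCast,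
    Real.sq_sqrt (Nat.cast_nonneg D)]

/-- The square of the denominator of q divides D, so the denominator is 1. -/
theorem exists_int_of_squarefree_mul_sq {D : ℕ} (hsq : Squarefree D) {q : ℚ} {k : ℤ}
    (h : D * q ^ 2 = k) : ∃ u : ℤ, q = u := by
  have h1 : (D : ℤ) * q.num ^ 2 = k * (q.den : ℤ) ^ 2 := by
    have hd : (q.den : ℚ) ≠ 0 := by exact_mod_cast q.den_nz
    have : (D : ℚ) * q.num ^ 2 = k * (q.den : ℚ) ^ 2 := by
      rw [← h]
      nth_rewrite 2 [← Rat.num_div_den q]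
      field_simp
    exact_mod_cast this
  have h2 : q.den ^ 2 ∣ D * q.num.natAbs ^ 2 := by
    have := congrArg Int.natAbs h1
    simp only [Int.natAbs_mul, Int.natAbs_pow, Int.natAbs_natCast] at this
    rw [this]
    exact dvd_mul_left _ _
  have h3 : q.den ^ 2 ∣ D := (q.reduced.symm.pow 2 2).dvd_of_dvd_mul_right h2
  have h4 : q.den = 1 := Nat.isUnit_iff.1 (hsq q.den (by rwa [← sq]))
  exact ⟨q.num, by rw [← Rat.num_div_den q, h4]; simp⟩

theorem exists_int_of_isIntegral_ratCast {q : ℚ} (h : IsIntegral ℤ (q : ℝ)) : ∃ k : ℤ, q = k := by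
  have h1 : IsIntegral ℤ (algebraMap ℚ ℝ q) := h
  rw [isIntegral_algebraMap_iff (algebraMap ℚ ℝ).injective,
    IsIntegrallyClosed.isIntegral_iff] at h1
  obtain ⟨k, hk⟩ := h1
  exact ⟨k, by rw [← hk]; simp⟩

/-- Integers of `ℚ(√D)` have integral coordinates in the basis `1, ω`. -/
theorem exists_int_coords {D : ℕ} (hsq : Squarefree D) {τ : RealQuadField D →+* ℝ}
    (hτ : τ (quadGen D) = -√(D : ℝ)) (x : 𝓞 (RealQuadField D)) :
    ∃ a n : ℤ, algebraMap (RealQuadField D) ℝ x = a + n * quadOmega D ∧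
      τ x = a + n * quadOmegaConj D := by
  obtain ⟨p, q, hpq⟩ := exists_rat_coords (x : RealQuadField D)
  have hσx : algebraMap (RealQuadField D) ℝ x = p + q * √(D : ℝ) := by
    rw [hpq, map_add, map_mul, map_ratCast, map_ratCast]; rfl
  have hτx : τ x = p - q * √(D : ℝ) := by
    rw [hpq, map_add, map_mul, map_ratCast, map_ratCast, hτ]; ring
  have hint : IsIntegral ℤ (x : RealQuadField D) := x.isIntegral_coe
  have h1 : IsIntegral ℤ (algebraMap (RealQuadField D) ℝ x) :=
    map_isIntegral_int (algebraMap (RealQuadField D) ℝ) hint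
  have h2 : IsIntegral ℤ (τ x) := map_isIntegral_int τ hint
  rw [hσx] at h1
  rw [hτx] at h2
  have hs := Real.sq_sqrt (Nat.cast_nonneg (α := ℝ) D)
  -- The trace t = 2p and the norm N are rational algebraic integers, so u = 2q is an integer too,
  -- and t² − Du² = 4N. Reading this modulo 4 gives the parities of t and u.
  obtain ⟨t, ht⟩ := exists_int_of_isIntegral_ratCast (q := 2 * p) (by
    have e : ((2 * p : ℚ) : ℝ) = (p + q * √(D : ℝ)) + (p - q * √(D : ℝ)) := by push_cast; ring
    rw [e]; exact h1.add h2)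
  obtain ⟨N, hN⟩ := exists_int_of_isIntegral_ratCast (q := p ^ 2 - D * q ^ 2) (by
    have e : ((p ^ 2 - D * q ^ 2 : ℚ) : ℝ) = (p + q * √(D : ℝ)) * (p - q * √(D : ℝ)) := by
      push_cast; linear_combination (q : ℝ) ^ 2 * hs
    rw [e]; exact h1.mul h2)
  obtain ⟨u, hu⟩ := exists_int_of_squarefree_mul_sq hsq (q := 2 * q) (k := t ^ 2 - 4 * N) (by
    push_cast; rw [← ht, ← hN]; ring)
  have htu : t ^ 2 - D * u ^ 2 = 4 * N := by
    have : (t : ℚ) ^ 2 - D * u ^ 2 = 4 * N := by rw [← ht, ← hu, ← hN]; ring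
    exact_mod_cast this
  have hp : (p : ℝ) = t / 2 := by
    have : (2 * p : ℝ) = t := by exact_mod_cast congrArg (Rat.cast : ℚ → ℝ) ht
    linarith
  have hq : (q : ℝ) = u / 2 := by
    have : (2 * q : ℝ) = u := by exact_mod_cast congrArg (Rat.cast : ℚ → ℝ) hu
    linarith
  have hmod : ∀ v : ℤ, (v % 2 = 0 ∧ v ^ 2 % 4 = 0) ∨ (v % 2 = 1 ∧ v ^ 2 % 4 = 1) := by
    intro v
    rcases Int.emod_two_eq_zero_or_one v with h | h
    · obtain ⟨k, rfl⟩ : ∃ k, v = 2 * k := ⟨v / 2, by omega⟩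
      exact Or.inl ⟨h, by ring_nf; omega⟩
    · obtain ⟨k, rfl⟩ : ∃ k, v = 2 * k + 1 := ⟨v / 2, by omega⟩
      exact Or.inr ⟨h, by ring_nf; omega⟩
  have hDu : ((D : ℤ) * u ^ 2) % 4 = ((D : ℤ) % 4) * (u ^ 2 % 4) % 4 := Int.mul_emod _ _ _
  rw [hσx, hτx, hp, hq, quadOmega, quadOmegaConj]
  by_cases hD1 : D % 4 = 1
  · have hD1' : (D : ℤ) % 4 = 1 := by omega
    rw [hD1'] at hDu
    obtain ⟨k, hk⟩ : ∃ k : ℤ, t = 2 * k + u := by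
      refine ⟨(t - u) / 2, ?_⟩
      rcases hmod t with ⟨h1, h2⟩ | ⟨h1, h2⟩ <;> rcases hmod u with ⟨h3, h4⟩ | ⟨h3, h4⟩ <;>
        rw [h4] at hDu <;> omega
    rw [if_pos hD1, if_pos hD1, hk]
    exact ⟨k, u, by push_cast; ring, by push_cast; ring⟩
  · have hD4 : (D : ℤ) % 4 = 2 ∨ (D : ℤ) % 4 = 3 := by
      have : ¬ D % 4 = 0 := fun h =>
        absurd (hsq 2 (Nat.dvd_of_mod_eq_zero h)) (by decide)
      omega
    obtain ⟨⟨k, hk⟩, l, hl⟩ : (∃ k : ℤ, t = 2 * k) ∧ ∃ l : ℤ, u = 2 * l := by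
      have : t % 2 = 0 ∧ u % 2 = 0 := by
        rcases hD4 with hD4 | hD4 <;> rw [hD4] at hDu <;>
        rcases hmod t with ⟨h1, h2⟩ | ⟨h1, h2⟩ <;> rcases hmod u with ⟨h3, h4⟩ | ⟨h3, h4⟩ <;>
        rw [h4] at hDu <;> omega
      exact ⟨⟨t / 2, by omega⟩, u / 2, by omega⟩
    rw [if_neg hD1, if_neg hD1, hk, hl]
    exact ⟨k, l, by push_cast; ring, by push_cast; ring⟩

theorem exists_ringOfIntegers_coords {D : ℕ} {τ : RealQuadField D →+* ℝ}
    (hτ : τ (quadGen D) = -√(D : ℝ)) (a n : ℤ) :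
    ∃ x : 𝓞 (RealQuadField D), algebraMap (RealQuadField D) ℝ x = a + n * quadOmega D ∧
      τ x = a + n * quadOmegaConj D := by
  suffices ∃ y : 𝓞 (RealQuadField D), algebraMap (RealQuadField D) ℝ y = quadOmega D ∧
      τ y = quadOmegaConj D by
    obtain ⟨y, h1, h2⟩ := this
    refine ⟨a + n * y, ?_, ?_⟩
    · rw [← h1]; simp
    · rw [← h2]; simp
  have hs := quadGen_sq D
  by_cases hD1 : D % 4 = 1
  · have hint : IsIntegral ℤ ((1 + quadGen D) / 2) := by
      refine ⟨X ^ 2 - X - C ((D / 4 : ℕ) : ℤ), ?_, ?_⟩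
      · monicity!
      -- Here `D / 4` is a floor, equal to (D − 1)/4 because D ≡ 1 modulo 4.
      · have hk : (D : RealQuadField D) = 4 * (D / 4 : ℕ) + 1 := by
          have : D = 4 * (D / 4) + 1 := by omega
          exact_mod_cast congrArg (Nat.cast : ℕ → RealQuadField D) this
        rw [eval₂_sub, eval₂_sub, eval₂_pow, eval₂_X, eval₂_C, eq_intCast, Int.cast_natCast]
        linear_combination (1 / 4 : RealQuadField D) * hs + (1 / 4 : RealQuadField D) * hk
    refine ⟨⟨_, hint⟩, ?_, ?_⟩
    · rw [quadOmega, if_pos hD1]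
      change algebraMap (RealQuadField D) ℝ ((1 + quadGen D) / 2) = _
      rw [map_div₀, map_add, map_one, map_ofNat]; rfl
    · rw [quadOmegaConj, if_pos hD1]
      change τ ((1 + quadGen D) / 2) = _
      rw [map_div₀, map_add, map_one, map_ofNat, hτ]; rfl
  · have hint : IsIntegral ℤ (quadGen D) := by
      refine ⟨X ^ 2 - C (D : ℤ), monic_X_pow_sub_C _ two_ne_zero, ?_⟩
      rw [eval₂_sub, eval₂_pow, eval₂_X, eval₂_C, quadGen_sq]
      simp
    refine ⟨⟨_, hint⟩, ?_, ?_⟩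
    · rw [quadOmega, if_neg hD1]
      rfl
    · rw [quadOmegaConj, if_neg hD1]
      exact hτ

end

/-! ### Gram matrices of lattices under real embeddings -/

section

open Matrix

/-- All entries are at most m in absolute value by 2×2 minors, and 2|xᵢxⱼ| ≤ xᵢ² + xⱼ² does the
rest. -/
theorem posSemidef_card_mul_sub {κ : Type*} [Fintype κ] [DecidableEq κ] {G : Matrix κ κ ℝ}
    (hG : G.PosSemidef) {m : ℝ} (hm : 0 ≤ m) (hdiag : ∀ i, G i i ≤ m) :
    ((Fintype.card κ * m) • (1 : Matrix κ κ ℝ) - G).PosSemidef := by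
  refine PosSemidef.of_dotProduct_mulVec_nonneg
    ((isHermitian_one.smul (IsSelfAdjoint.all _)).sub hG.isHermitian) fun x => ?_
  rw [sub_mulVec, dotProduct_sub, smul_mulVec, one_mulVec, dotProduct_smul, sub_nonneg]
  simp only [star_trivial, dotProduct, mulVec, smul_eq_mul, Finset.mul_sum]
  have hent : ∀ i j, |G i j| ≤ m := fun i j => by
    refine abs_le_of_sq_le_sq ?_ hm
    calc G i j ^ 2 ≤ G i i * G j j := posSemidef_sq_le hG i j
      _ ≤ m * m := mul_le_mul (hdiag i) (hdiag j) (posSemidef_diag_nonneg hG j) hm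
      _ = m ^ 2 := by ring
  calc ∑ i, ∑ j, x i * (G i j * x j) ≤ ∑ i, ∑ j, (m * x i ^ 2 / 2 + m * x j ^ 2 / 2) := by
        refine Finset.sum_le_sum fun i _ => Finset.sum_le_sum fun j _ => ?_
        calc x i * (G i j * x j) ≤ |x i * (G i j * x j)| := le_abs_self _
          _ = |G i j| * (|x i| * |x j|) := by rw [abs_mul, abs_mul]; ring
          _ ≤ m * (|x i| * |x j|) := mul_le_mul_of_nonneg_right (hent i j) (by positivity)
          _ ≤ _ := by
            rw [← sq_abs (x i), ← sq_abs (x j)]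
            nlinarith [mul_nonneg hm (sq_nonneg (|x i| - |x j|))]
    _ = ∑ i, Fintype.card κ * m * (x i * x i) := by
        simp only [Finset.sum_add_distrib, Finset.sum_const, Finset.card_univ, nsmul_eq_mul]
        rw [Finset.mul_sum, ← Finset.sum_add_distrib]
        refine Finset.sum_congr rfl fun i _ => ?_
        ring

/-- Split on the κ-part of a nonzero vector: if it vanishes, only the first diagonal block matters;
if not, sN contributes a positive amount to a nonnegative one. -/
theorem posDef_of_add_fromBlocks {ι κ : Type*} [Fintype ι] [Fintype κ]
    {T T' : Matrix (ι ⊕ κ) (ι ⊕ κ) ℝ} {N : Matrix κ κ ℝ} {s : ℝ} (hs : 0 < s)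
    (hT' : T'.PosSemidef) (hT : T = T' + fromBlocks 0 0 0 (s • N))
    (hA : T.toBlocks₁₁.PosDef) (hN : N.PosDef) : T.PosDef := by
  have hB : (fromBlocks (0 : Matrix ι ι ℝ) 0 0 (s • N)).IsHermitian := by
    rw [isHermitian_fromBlocks_iff]
    exact ⟨isHermitian_zero, by simp, by simp, (hN.smul hs).isHermitian⟩
  refine PosDef.of_dotProduct_mulVec_pos (by rw [hT]; exact hT'.isHermitian.add hB) fun z hz => ?_
  by_cases hy : z ∘ Sum.inr = 0
  · have hx : z ∘ Sum.inl ≠ 0 := by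
      intro hx
      apply hz
      ext i
      rcases i with i | i
      · exact congrFun hx i
      · exact congrFun hy i
    have h1 := hA.dotProduct_mulVec_pos hx
    have h2 : star z ⬝ᵥ (T *ᵥ z) = star (z ∘ Sum.inl) ⬝ᵥ (T.toBlocks₁₁ *ᵥ (z ∘ Sum.inl)) := by
      have hy' : ∀ k, z (Sum.inr k) = 0 := fun k => congrFun hy k
      simp [dotProduct, mulVec, Fintype.sum_sum_type, hy', toBlocks₁₁]
    rw [h2]
    exact h1
  · have h1 := (hN.smul hs).dotProduct_mulVec_pos hy
    have h0 := hT'.dotProduct_mulVec_nonneg z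
    have h2 : star z ⬝ᵥ (fromBlocks 0 0 0 (s • N) *ᵥ z) =
        star (z ∘ Sum.inr) ⬝ᵥ ((s • N) *ᵥ (z ∘ Sum.inr)) := by
      simp [dotProduct, mulVec, Fintype.sum_sum_type, fromBlocks]
    rw [hT, add_mulVec, dotProduct_add, h2]
    exact add_pos_of_nonneg_of_pos h0 h1

/-! ### Gram matrices of lattice vectors and lower bounds for the rank -/

section Gram

variable {F V : Type*} [Field F] [AddCommGroup V] [Module F V]

theorem latticeB_comm (Q : QuadraticForm F V) (v w : V) : latticeB Q v w = latticeB Q w v := by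
  rw [latticeB, latticeB, add_comm v w, sub_right_comm]

theorem latticeB_self [CharZero F] (Q : QuadraticForm F V) (v : V) : latticeB Q v v = Q v := by
  have : Q (v + v) = 4 * Q v := by
    rw [← two_smul F v, QuadraticMap.map_smul, smul_eq_mul]; ring
  rw [latticeB, this]
  ring

theorem map_sum_smul_eq [CharZero F] (Q : QuadraticForm F V) {ι : Type*} [Fintype ι] (e : ι → V)
    (z : ι → F) :
    Q (∑ i, z i • e i) = ∑ i, ∑ j, z i * (latticeB Q (e i) (e j) * z j) := by
  have hB : ∀ v w, latticeB Q v w = (2⁻¹ : F) * Q.polarBilin v w := fun v w => by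
    rw [latticeB, QuadraticMap.polarBilin_apply_apply, QuadraticMap.polar, div_eq_inv_mul]
  rw [← latticeB_self, hB]
  simp only [map_sum, LinearMap.sum_apply, map_smul, LinearMap.smul_apply, smul_eq_mul,
    Finset.mul_sum, hB]
  rw [Finset.sum_comm]
  refine Finset.sum_congr rfl fun i _ => Finset.sum_congr rfl fun j _ => ?_
  ring

/-- The Gram matrix of a family of vectors under a real embedding. -/
def latticeGram (Q : QuadraticForm F V) (σ : F →+* ℝ) {ι : Type*} (e : ι → V) : Matrix ι ι ℝ :=
  of fun i j => σ (latticeB Q (e i) (e j))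

theorem latticeGram_apply (Q : QuadraticForm F V) (σ : F →+* ℝ) {ι : Type*} (e : ι → V) (i j : ι) :
    latticeGram Q σ e i j = σ (latticeB Q (e i) (e j)) := rfl

theorem latticeGram_isHermitian (Q : QuadraticForm F V) (σ : F →+* ℝ) {ι : Type*} (e : ι → V) :
    (latticeGram Q σ e).IsHermitian := by
  ext i j
  simp [latticeGram, latticeB_comm Q (e j) (e i)]

theorem dotProduct_latticeGram_mulVec [CharZero F] (Q : QuadraticForm F V) (σ : F →+* ℝ)
    {ι : Type*} [Fintype ι] (e : ι → V) (z : ι → F) :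
    (σ ∘ z) ⬝ᵥ (latticeGram Q σ e *ᵥ (σ ∘ z)) = σ (Q (∑ i, z i • e i)) := by
  rw [map_sum_smul_eq]
  simp [dotProduct, mulVec, latticeGram, Finset.mul_sum]

theorem linearIndependent_of_posDef_latticeGram [CharZero F] {Q : QuadraticForm F V} {σ : F →+* ℝ}
    {ι : Type*} [Fintype ι] {e : ι → V} (h : (latticeGram Q σ e).PosDef) :
    LinearIndependent F e := by
  rw [Fintype.linearIndependent_iff]
  intro z hz i
  by_contra hne
  have hne' : σ ∘ z ≠ 0 := fun h0 => hne (by simpa using congrFun h0 i)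
  have h1 := h.dotProduct_mulVec_pos hne'
  rw [star_trivial, dotProduct_latticeGram_mulVec, hz] at h1
  simp at h1

variable [Module (𝓞 F) V] {L : Submodule (𝓞 F) V} {Q : QuadraticForm F V}

theorem mem_latticeSpace {v : V} (hv : v ∈ L) : v ∈ latticeSpace L := Submodule.subset_span hv

/-- Definiteness controls only vectors with coefficients in F. Rational coefficients are dense in
the real ones, and nonnegativity passes to the closure; strict positivity does not. -/
theorem latticeGram_posSemidef [CharZero F] (hpos : IsTotPosDefLattice Q L) (σ : F →+* ℝ)
    {ι : Type*} [Fintype ι] {e : ι → V} (he : ∀ i, e i ∈ L) : (latticeGram Q σ e).PosSemidef := by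
  refine PosSemidef.of_dotProduct_mulVec_nonneg (latticeGram_isHermitian Q σ e) fun x => ?_
  have hd : DenseRange (Pi.map fun (_ : ι) (q : ℚ) => (q : ℝ)) :=
    DenseRange.piMap fun _ => Rat.denseRange_cast
  refine hd.induction_on (p := fun x => 0 ≤ star x ⬝ᵥ (latticeGram Q σ e *ᵥ x)) x ?_ fun z => ?_
  · refine isClosed_le continuous_const ?_
    simp only [star_trivial, dotProduct, mulVec]
    fun_prop
  · have hz : (Pi.map fun (_ : ι) (q : ℚ) => (q : ℝ)) z = σ ∘ fun i => (z i : F) := by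
      ext i; simp
    rw [hz, star_trivial, dotProduct_latticeGram_mulVec]
    by_cases h0 : ∑ i, (z i : F) • e i = 0
    · simp [h0]
    · refine (hpos _ (Submodule.sum_mem _ fun i _ => Submodule.smul_mem _ _
        (mem_latticeSpace (he i))) h0 σ).le

theorem card_le_latticeRank [IsScalarTower (𝓞 F) F V] (hfg : L.FG) {ι : Type*} [Fintype ι]
    {e : ι → V} (he : ∀ i, e i ∈ L) (hli : LinearIndependent F e) :
    Fintype.card ι ≤ latticeRank L := by
  have hfin : Module.Finite F (latticeSpace L) := by
    obtain ⟨S, hS⟩ := hfg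
    rw [latticeSpace, ← hS, Submodule.span_span_of_tower]
    exact Module.Finite.span_of_finite F S.finite_toSet
  have hli' : LinearIndependent F fun i => (⟨e i, mem_latticeSpace (he i)⟩ : latticeSpace L) :=
    LinearIndependent.of_comp (latticeSpace L).subtype hli
  exact hli'.fintype_card_le_finrank

/-- The sum of the ranks of a family whose products are fixed by conjugation, and of a family whose
Gram matrix grows positively under conjugation, is a lower bound for the rank of the lattice. -/
theorem card_add_card_le_latticeRank [CharZero F] [IsScalarTower (𝓞 F) F V] (hfg : L.FG)
    (hpos : IsTotPosDefLattice Q L) {σ τ : F →+* ℝ} {ι κ : Type*} [Fintype ι] [Fintype κ]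
    {v : ι → V} {w : κ → V} (hv : ∀ i, v i ∈ L) (hw : ∀ j, w j ∈ L)
    (hvv : ∀ i i', σ (latticeB Q (v i) (v i')) = τ (latticeB Q (v i) (v i')))
    (hvw : ∀ i j, σ (latticeB Q (v i) (w j)) = τ (latticeB Q (v i) (w j)))
    {N : Matrix κ κ ℝ} {s : ℝ} (hs : 0 < s)
    (hww : latticeGram Q σ w = latticeGram Q τ w + s • N)
    (hA : (latticeGram Q σ v).PosDef) (hN : N.PosDef) :
    Fintype.card ι + Fintype.card κ ≤ latticeRank L := by
  have he : ∀ i, Sum.elim v w i ∈ L := by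
    rintro (i | i)
    · exact hv i
    · exact hw i
  rw [← Fintype.card_sum]
  refine card_le_latticeRank hfg he (linearIndependent_of_posDef_latticeGram (Q := Q) (σ := σ) ?_)
  refine posDef_of_add_fromBlocks hs (latticeGram_posSemidef hpos τ he) ?_ hA hN
  ext i j
  rcases i with i | i <;> rcases j with j | j
  · simpa [latticeGram] using hvv i j
  · simpa [latticeGram] using hvw i j
  · simpa [latticeGram, latticeB_comm Q (w i)] using hvw j i
  · have := congrFun (congrFun hww i) j
    simpa [latticeGram] using this

theorem sq_map_latticeB_le [CharZero F] (hpos : IsTotPosDefLattice Q L) (σ : F →+* ℝ) {v w : V}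
    (hv : v ∈ L) (hw : w ∈ L) : σ (latticeB Q v w) ^ 2 ≤ σ (Q v) * σ (Q w) := by
  have h := posSemidef_sq_le (latticeGram_posSemidef hpos σ (e := ![v, w])
    (by intro i; fin_cases i <;> simp [hv, hw])) 0 1
  simpa [latticeGram, latticeB_self] using h

/-- Both conjugates of B(v, w) are at most √(XY) in absolute value, so (sn)² ≤ 4XY < s², which no
nonzero integer n allows. -/
theorem map_latticeB_eq_of_lt [CharZero F] (hpos : IsTotPosDefLattice Q L) {σ τ : F →+* ℝ}
    {v w : V} (hv : v ∈ L) (hw : w ∈ L) {s X Y : ℝ} {n : ℤ}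
    (hn : σ (latticeB Q v w) = τ (latticeB Q v w) + s * n) (hX : 0 ≤ X)
    (hσv : σ (Q v) ≤ X) (hσw : σ (Q w) ≤ Y) (hτv : τ (Q v) ≤ X) (hτw : τ (Q w) ≤ Y)
    (hlt : 4 * (X * Y) < s ^ 2) : n = 0 := by
  have hnn : ∀ (ρ : F →+* ℝ) {u : V}, u ∈ L → 0 ≤ ρ (Q u) := fun ρ u hu => by
    by_cases h0 : u = 0
    · simp [h0]
    · exact (hpos u (mem_latticeSpace hu) h0 ρ).le
  have h1 : σ (latticeB Q v w) ^ 2 ≤ X * Y :=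
    (sq_map_latticeB_le hpos σ hv hw).trans (mul_le_mul hσv hσw (hnn σ hw) hX)
  have h2 : τ (latticeB Q v w) ^ 2 ≤ X * Y :=
    (sq_map_latticeB_le hpos τ hv hw).trans (mul_le_mul hτv hτw (hnn τ hw) hX)
  by_contra hne
  have h3 : (1 : ℝ) ≤ (n : ℝ) ^ 2 := by
    have : 0 < n ^ 2 := by positivity
    have : 1 ≤ n ^ 2 := by omega
    exact_mod_cast this
  have h4 : (s * n) ^ 2 ≤ 4 * (X * Y) := by
    have : s * n = σ (latticeB Q v w) - τ (latticeB Q v w) := by rw [hn]; ring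
    rw [this]
    nlinarith [sq_nonneg (σ (latticeB Q v w) + τ (latticeB Q v w))]
  nlinarith [mul_le_mul_of_nonneg_left h3 (sq_nonneg s)]

/-- The matrix of `ω`-coordinates is nearly positive semidefinite. -/
theorem posSemidef_add_smul_one [CharZero F] (hpos : IsTotPosDefLattice Q L) {σ τ : F →+* ℝ}
    {κ : Type*} [Fintype κ] [DecidableEq κ] {w : κ → V} (hw : ∀ j, w j ∈ L)
    {N : Matrix κ κ ℝ} {s m : ℝ} (hs : 0 < s) (hm : 0 ≤ m) (hτ : ∀ j, τ (Q (w j)) ≤ m)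
    (hww : latticeGram Q σ w = latticeGram Q τ w + s • N) :
    (N + (Fintype.card κ * m / s) • (1 : Matrix κ κ ℝ)).PosSemidef := by
  -- With k vectors, sN + km = G_σ + (km − G_τ) is a sum of two positive semidefinite matrices.
  have h1 := (latticeGram_posSemidef hpos σ hw).add (posSemidef_card_mul_sub
    (latticeGram_posSemidef hpos τ hw) hm fun j => by
      rw [latticeGram_apply, latticeB_self]; exact hτ j)
  have h2 : N + (Fintype.card κ * m / s) • (1 : Matrix κ κ ℝ) =
      s⁻¹ • (latticeGram Q σ w + ((Fintype.card κ * m) • 1 - latticeGram Q τ w)) := by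
    rw [hww]
    ext i j
    simp only [Matrix.add_apply, Matrix.smul_apply, Matrix.sub_apply, smul_eq_mul]
    field_simp
    ring
  rw [h2]
  exact h1.smul (by positivity)

end Gram

end

/-! ### Integral coordinates of Gram matrices -/

section

open Matrix

theorem sq_ne_two_mul_sq {m : ℕ} (hm : 0 < m) (b : ℤ) : b ^ 2 ≠ 2 * (m : ℤ) ^ 2 := by
  intro h
  have hm' : (m : ℚ) ≠ 0 := by positivity
  have h1 : (b : ℚ) ^ 2 = 2 * (m : ℚ) ^ 2 := by exact_mod_cast h
  have h2 : IsSquare ((2 : ℕ) : ℚ) := ⟨b / m, by field_simp; rw [h1]; push_cast; ring⟩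
  exact Nat.prime_two.prime.not_isSquare (Rat.isSquare_natCast_iff.1 h2)

/-- With δ = 2m/s the bound on s gives 8mδ ≤ 1, so b² ≤ (m + δ)(2m + δ) < 2m² + 1. Equality b² = 2m²
is ruled out by the irrationality of √2. -/
theorem sq_lt_of_nearly_posSemidef {m : ℕ} (hm : 0 < m) {b : ℤ} {s : ℝ} (hs : 16 * (m : ℝ) ^ 2 < s)
    (h : ((!![(m : ℤ), b; b, 2 * m]).map (Int.cast : ℤ → ℝ) +
      (2 * m / s) • (1 : Matrix (Fin 2) (Fin 2) ℝ)).PosSemidef) : b ^ 2 < 2 * (m : ℤ) ^ 2 := by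
  have hm1 : (1 : ℝ) ≤ m := by exact_mod_cast hm
  have hs0 : 0 < s := lt_trans (by positivity) hs
  have hδ0 : 0 ≤ 2 * (m : ℝ) / s := by positivity
  have hδ : 8 * m * (2 * (m : ℝ) / s) ≤ 1 := by
    rw [← mul_div_assoc, div_le_one hs0]; nlinarith
  have h1 := posSemidef_sq_le h 0 1
  generalize 2 * (m : ℝ) / s = δ at *
  simp at h1
  have h2 : (b : ℝ) ^ 2 < 2 * (m : ℝ) ^ 2 + 1 := by nlinarith
  have h3 : b ^ 2 < 2 * (m : ℤ) ^ 2 + 1 := by exact_mod_cast h2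
  exact lt_of_le_of_ne (Int.lt_add_one_iff.1 h3) (sq_ne_two_mul_sq hm b)

theorem int_det_pos {k : ℕ} {N : Matrix (Fin k) (Fin k) ℤ} (h0 : N.det ≠ 0)
    (h : -(N.map (Int.cast : ℤ → ℝ)).det < 1) : 0 < N.det := by
  have h1 : (N.map (Int.cast : ℤ → ℝ)).det = N.det := ((Int.castRingHom ℝ).map_det N).symm
  rw [h1] at h
  have h2 : -1 < N.det := by
    have : (-1 : ℝ) < N.det := by linarith
    exact_mod_cast this
  omega

/-- With δ = 3m/s the bound on s gives 12Cm²δ ≤ 1, and −det is at most 5Cm²δ + δ³ < 1. An integer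
above −1 and nonzero is positive. -/
theorem det_ternary_pos_of_nearly_posSemidef {m C : ℕ} (hm : 0 < m) (hC : 2 ≤ C) {b c e : ℤ}
    {s : ℝ} (hs : 36 * C * (m : ℝ) ^ 3 < s)
    (h : ((!![(m : ℤ), b, c; b, 2 * m, e; c, e, C * m]).map (Int.cast : ℤ → ℝ) +
      (3 * m / s) • (1 : Matrix (Fin 3) (Fin 3) ℝ)).PosSemidef)
    (hdet : det !![(m : ℤ), b, c; b, 2 * m, e; c, e, C * m] ≠ 0) :
    0 < det !![(m : ℤ), b, c; b, 2 * m, e; c, e, C * m] := by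
  have hm1 : (1 : ℝ) ≤ m := by exact_mod_cast hm
  have hC2 : (2 : ℝ) ≤ C := by exact_mod_cast hC
  have hs0 : 0 < s := lt_of_le_of_lt (by positivity) hs
  have hδ0 : 0 ≤ 3 * (m : ℝ) / s := by positivity
  have hδ : 12 * (C * m ^ 2) * (3 * (m : ℝ) / s) ≤ 1 := by
    rw [← mul_div_assoc, div_le_one hs0]; nlinarith
  refine int_det_pos hdet ?_
  have hform : (!![(m : ℤ), b, c; b, 2 * m, e; c, e, C * m]).map (Int.cast : ℤ → ℝ) =
      !![(m : ℝ), b, c; b, 2 * m, e; c, e, C * m] := by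
    ext i j
    fin_cases i <;> fin_cases j <;> simp
  rw [hform] at h ⊢
  refine (neg_det_ternary_le hδ0 h).trans_lt ?_
  generalize 3 * (m : ℝ) / s = δ at *
  have hCm : (2 : ℝ) ≤ C * m ^ 2 := by nlinarith
  have hδ1 : δ ≤ 1 / 24 := by nlinarith
  have e1 : (m + δ) * (2 * m + δ) + (m + δ) * (C * m + δ) + (2 * m + δ) * (C * m + δ) ≤
      5 * (C * m ^ 2) := by
    calc _ ≤ ((25 / 24 : ℝ) * m) * ((25 / 24 : ℝ) * (2 * m)) + ((25 / 24 : ℝ) * m) * ((25 / 24 : ℝ) * (C * m)) +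
          ((25 / 24 : ℝ) * (2 * m)) * ((25 / 24 : ℝ) * (C * m)) := by
          gcongr <;> nlinarith
      _ = (25 / 24 : ℝ) ^ 2 * (2 * m ^ 2 + 3 * (C * m ^ 2)) := by ring
      _ ≤ (5 : ℝ) * (C * m ^ 2) := by nlinarith [sq_nonneg (m : ℝ)]
  have e2 := mul_le_mul_of_nonneg_left e1 hδ0
  have e3 : δ ^ 3 ≤ 1 / 24 := by nlinarith [mul_nonneg hδ0 hδ0]
  nlinarith

/-- With δ = 4m/s the bound on s gives 48CDm³δ ≤ 1, and each of the two terms bounding −det is at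
most 7CDm³δ. -/
theorem det_quaternary_pos_of_nearly_posSemidef {m C D : ℕ} (hm : 0 < m) (hC : 2 ≤ C) (hD : 1 ≤ D)
    {b c e f g i : ℤ} {s : ℝ} (hs : 192 * C * D * (m : ℝ) ^ 4 < s)
    (h : ((!![(m : ℤ), b, c, f; b, 2 * m, e, g; c, e, C * m, i; f, g, i, D * m]).map
      (Int.cast : ℤ → ℝ) + (4 * m / s) • (1 : Matrix (Fin 4) (Fin 4) ℝ)).PosSemidef)
    (hdet : det !![(m : ℤ), b, c, f; b, 2 * m, e, g; c, e, C * m, i; f, g, i, D * m] ≠ 0) :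
    0 < det !![(m : ℤ), b, c, f; b, 2 * m, e, g; c, e, C * m, i; f, g, i, D * m] := by
  have hm1 : (1 : ℝ) ≤ m := by exact_mod_cast hm
  have hC2 : (2 : ℝ) ≤ C := by exact_mod_cast hC
  have hD1 : (1 : ℝ) ≤ D := by exact_mod_cast hD
  have hs0 : 0 < s := lt_of_le_of_lt (by positivity) hs
  have hδ0 : 0 ≤ 4 * (m : ℝ) / s := by positivity
  have hδ : 48 * (C * D * m ^ 3) * (4 * (m : ℝ) / s) ≤ 1 := by
    rw [← mul_div_assoc, div_le_one hs0]; nlinarith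
  refine int_det_pos hdet ?_
  have hform : (!![(m : ℤ), b, c, f; b, 2 * m, e, g; c, e, C * m, i; f, g, i, D * m]).map
      (Int.cast : ℤ → ℝ) =
      !![(m : ℝ), b, c, f; b, 2 * m, e, g; c, e, C * m, i; f, g, i, D * m] := by
    ext i j
    fin_cases i <;> fin_cases j <;> simp
  rw [hform] at h ⊢
  refine (neg_det_quaternary_le hδ0 h).trans_lt ?_
  generalize 4 * (m : ℝ) / s = δ at *
  have hCD : (2 : ℝ) ≤ C * D := by nlinarith
  have hm3 : (1 : ℝ) ≤ m ^ 3 := one_le_pow₀ hm1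
  have hP : (2 : ℝ) ≤ C * D * m ^ 3 := by nlinarith
  have hδ1 : δ ≤ 1 / 96 := by nlinarith
  have hCle : (C : ℝ) ≤ C * D := by nlinarith
  have hDle : 2 * (D : ℝ) ≤ C * D := by nlinarith
  have hCm : δ ≤ 1 / 96 * (C * m) := by nlinarith
  have hDm : δ ≤ 1 / 96 * (D * m) := by nlinarith
  have e1 : (m + δ) * (2 * m + δ) * (C * m + δ) + (m + δ) * (2 * m + δ) * (D * m + δ) +
      (m + δ) * (C * m + δ) * (D * m + δ) + (2 * m + δ) * (C * m + δ) * (D * m + δ) ≤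
      7 * (C * D * m ^ 3) := by
    calc _ ≤ ((97 / 96 : ℝ) * m) * ((97 / 96 : ℝ) * (2 * m)) * ((97 / 96 : ℝ) * (C * m)) +
          ((97 / 96 : ℝ) * m) * ((97 / 96 : ℝ) * (2 * m)) * ((97 / 96 : ℝ) * (D * m)) +
          ((97 / 96 : ℝ) * m) * ((97 / 96 : ℝ) * (C * m)) * ((97 / 96 : ℝ) * (D * m)) +
          ((97 / 96 : ℝ) * (2 * m)) * ((97 / 96 : ℝ) * (C * m)) * ((97 / 96 : ℝ) * (D * m)) := by
          gcongr <;> linarith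
      _ = (97 / 96 : ℝ) ^ 3 * ((2 * C + 2 * D + 3 * (C * D)) * m ^ 3) := by ring
      _ ≤ (97 / 96 : ℝ) ^ 3 * ((6 * (C * D)) * m ^ 3) := by gcongr; linarith
      _ ≤ (7 : ℝ) * (C * D * m ^ 3) := by nlinarith
  have e2 := mul_le_mul_of_nonneg_left e1 hδ0
  have e3 : (m + δ) + (2 * m + δ) + (C * m + δ) + (D * m + δ) ≤ 7 * (C * D * m ^ 3) := by
    have h1 : (m : ℝ) ≤ m ^ 3 := le_self_pow₀ hm1 (by norm_num)
    calc _ ≤ (3 + C + D) * (m : ℝ) + 4 * (1 / 96) := by linarith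
      _ ≤ (3 + C + D) * (m : ℝ) ^ 3 + 1 := by gcongr; norm_num
      _ ≤ 3 * (C * D) * (m : ℝ) ^ 3 + 1 := by gcongr; linarith
      _ ≤ _ := by linarith
  have e4 : δ ^ 3 ≤ δ := by nlinarith [mul_nonneg hδ0 hδ0]
  have e5 : δ ^ 3 * ((m + δ) + (2 * m + δ) + (C * m + δ) + (D * m + δ)) ≤
      δ * (7 * (C * D * m ^ 3)) := mul_le_mul e4 e3 (by positivity) hδ0
  nlinarith

/-! ### Integer coordinates of products in the basis 1, ω -/

section Coords

variable {F V : Type*} [Field F] [AddCommGroup V] [Module F V]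

/-- The matrix of an integral coordinate of the entries of a Gram matrix. -/
def coordMatrix (f : F → ℤ) (Q : QuadraticForm F V) {ι : Type*} (e : ι → V) : Matrix ι ι ℤ :=
  of fun i j => f (latticeB Q (e i) (e j))

theorem coordMatrix_two (f : F → ℤ) (Q : QuadraticForm F V) (x y : V) :
    coordMatrix f Q ![x, y] = !![f (latticeB Q x x), f (latticeB Q x y);
      f (latticeB Q x y), f (latticeB Q y y)] := by
  ext i j
  fin_cases i <;> fin_cases j <;> simp [coordMatrix, latticeB_comm Q y x]

theorem coordMatrix_three (f : F → ℤ) (Q : QuadraticForm F V) (x y z : V) :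
    coordMatrix f Q ![x, y, z] =
      !![f (latticeB Q x x), f (latticeB Q x y), f (latticeB Q x z);
        f (latticeB Q x y), f (latticeB Q y y), f (latticeB Q y z);
        f (latticeB Q x z), f (latticeB Q y z), f (latticeB Q z z)] := by
  ext i j
  fin_cases i <;> fin_cases j <;>
    simp [coordMatrix, latticeB_comm Q y x, latticeB_comm Q z x, latticeB_comm Q z y]

theorem coordMatrix_four (f : F → ℤ) (Q : QuadraticForm F V) (x y z u : V) :
    coordMatrix f Q ![x, y, z, u] =
      !![f (latticeB Q x x), f (latticeB Q x y), f (latticeB Q x z), f (latticeB Q x u);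
        f (latticeB Q x y), f (latticeB Q y y), f (latticeB Q y z), f (latticeB Q y u);
        f (latticeB Q x z), f (latticeB Q y z), f (latticeB Q z z), f (latticeB Q z u);
        f (latticeB Q x u), f (latticeB Q y u), f (latticeB Q z u), f (latticeB Q u u)] := by
  ext i j
  fin_cases i <;> fin_cases j <;>
    simp [coordMatrix, latticeB_comm Q y x, latticeB_comm Q z x, latticeB_comm Q z y,
      latticeB_comm Q u x, latticeB_comm Q u y, latticeB_comm Q u z]

theorem coordMatrix_posDef_succ {f : F → ℤ} {Q : QuadraticForm F V} {k : ℕ} {e : Fin (k + 1) → V}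
    {e' : Fin k → V} (he : ∀ i, e i.castSucc = e' i)
    (h : ((coordMatrix f Q e').map (Int.cast : ℤ → ℝ)).PosDef)
    (hdet : 0 < (coordMatrix f Q e).det) :
    ((coordMatrix f Q e).map (Int.cast : ℤ → ℝ)).PosDef := by
  refine posDef_of_det_pos ?_ ?_ ?_
  · ext i j
    simp [coordMatrix, latticeB_comm Q (e j) (e i)]
  · convert h using 1
    ext i j
    simp [coordMatrix, he]
  · have h1 : ((coordMatrix f Q e).map (Int.cast : ℤ → ℝ)).det = (coordMatrix f Q e).det :=
      ((Int.castRingHom ℝ).map_det _).symm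
    rw [h1]
    exact_mod_cast hdet

variable [Module (𝓞 F) V]

/-- A totally positive definite lattice over a field with two real embeddings `σ`, `τ`, together
with integral coordinates `α`, `ν` of its products in the bases `1, ω` and `1, ω'`. -/
structure HasLatticeCoords (Q : QuadraticForm F V) (L : Submodule (𝓞 F) V) (σ τ : F →+* ℝ)
    (ω ω' : ℝ) (α ν : F → ℤ) : Prop where
  pos : IsTotPosDefLattice Q L
  two_le : 2 ≤ ω - ω'
  map_fst : ∀ v ∈ L, ∀ w ∈ L,
    σ (latticeB Q v w) = α (latticeB Q v w) + ν (latticeB Q v w) * ω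
  map_snd : ∀ v ∈ L, ∀ w ∈ L,
    τ (latticeB Q v w) = α (latticeB Q v w) + ν (latticeB Q v w) * ω'

namespace HasLatticeCoords

variable {Q : QuadraticForm F V} {L : Submodule (𝓞 F) V} {σ τ : F →+* ℝ} {ω ω' : ℝ} {α ν : F → ℤ}
  (H : HasLatticeCoords Q L σ τ ω ω' α ν)

include H

theorem sub_pos : 0 < ω - ω' := lt_of_lt_of_le two_pos H.two_le

theorem map_eq {v w : V} (hv : v ∈ L) (hw : w ∈ L) :
    σ (latticeB Q v w) = τ (latticeB Q v w) + (ω - ω') * ν (latticeB Q v w) := by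
  rw [H.map_fst v hv w hw, H.map_snd v hv w hw]; ring

theorem latticeGram_eq {κ : Type*} {w : κ → V} (hw : ∀ j, w j ∈ L) :
    latticeGram Q σ w = latticeGram Q τ w +
      (ω - ω') • (coordMatrix ν Q w).map (Int.cast : ℤ → ℝ) := by
  ext i j
  exact H.map_eq (hw i) (hw j)

variable [CharZero F]

theorem coord_eq_zero {v w : V} (hv : v ∈ L) (hw : w ∈ L) {X Y : ℝ} (hX : 0 ≤ X)
    (hσv : σ (Q v) ≤ X) (hσw : σ (Q w) ≤ Y) (hτv : τ (Q v) ≤ X) (hτw : τ (Q w) ≤ Y)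
    (hlt : 4 * (X * Y) < (ω - ω') ^ 2) : ν (latticeB Q v w) = 0 :=
  map_latticeB_eq_of_lt H.pos hv hw (H.map_eq hv hw) hX hσv hσw hτv hτw hlt

theorem coord_snd_self {v : V} (hv : v ∈ L) {c : ℤ} (hc : σ (Q v) - τ (Q v) = (ω - ω') * c) :
    ν (latticeB Q v v) = c := by
  have h := H.map_eq hv hv
  rw [latticeB_self] at h ⊢
  have h2 : (ω - ω') * ν (Q v) = (ω - ω') * c := by linarith
  exact_mod_cast mul_left_cancel₀ H.sub_pos.ne' h2

theorem coord_fst_self {v : V} (hv : v ∈ L) {c : ℕ} (hc : Q v = c) :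
    α (latticeB Q v v) = c := by
  have h0 : ν (latticeB Q v v) = 0 := H.coord_snd_self hv (by simp [hc])
  have h := H.map_fst v hv v hv
  rw [h0] at h
  rw [latticeB_self, hc] at h ⊢
  simp at h
  exact_mod_cast h.symm

/-- When all ω-coordinates vanish, the Gram matrix is the integer matrix of α-coordinates;
semidefinite with nonzero determinant means definite. -/
theorem posDef_latticeGram {k : ℕ} {v : Fin k → V} (hv : ∀ i, v i ∈ L)
    (h0 : ∀ i j, ν (latticeB Q (v i) (v j)) = 0) (hdet : (coordMatrix α Q v).det ≠ 0) :
    (latticeGram Q σ v).PosDef := by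
  rw [(latticeGram_posSemidef H.pos σ hv).posDef_iff_det_ne_zero]
  have h1 : latticeGram Q σ v = (coordMatrix α Q v).map (Int.cast : ℤ → ℝ) := by
    ext i j
    rw [latticeGram_apply, H.map_fst _ (hv i) _ (hv j), h0]
    simp [coordMatrix]
  have h2 : ((coordMatrix α Q v).map (Int.cast : ℤ → ℝ)).det = (coordMatrix α Q v).det :=
    ((Int.castRingHom ℝ).map_det _).symm
  rw [h1, h2]
  exact_mod_cast hdet

theorem nearly_posSemidef {k : ℕ} {w : Fin k → V} (hw : ∀ j, w j ∈ L) {m : ℝ} (hm : 0 ≤ m)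
    (hτ : ∀ j, τ (Q (w j)) ≤ m) : ((coordMatrix ν Q w).map (Int.cast : ℤ → ℝ) +
      (k * m / (ω - ω')) • (1 : Matrix (Fin k) (Fin k) ℝ)).PosSemidef := by
  have := posSemidef_add_smul_one H.pos hw H.sub_pos hm hτ (H.latticeGram_eq hw)
  rwa [Fintype.card_fin] at this

theorem add_le_latticeRank [IsScalarTower (𝓞 F) F V] (hfg : L.FG) {k l : ℕ} {v : Fin k → V}
    {w : Fin l → V} (hv : ∀ i, v i ∈ L) (hw : ∀ j, w j ∈ L)
    (hvv : ∀ i i', ν (latticeB Q (v i) (v i')) = 0) (hvw : ∀ i j, ν (latticeB Q (v i) (w j)) = 0)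
    (hA : (coordMatrix α Q v).det ≠ 0)
    (hN : ((coordMatrix ν Q w).map (Int.cast : ℤ → ℝ)).PosDef) : k + l ≤ latticeRank L := by
  have := card_add_card_le_latticeRank hfg H.pos hv hw
    (fun i i' => by rw [H.map_eq (hv i) (hv i'), hvv]; simp)
    (fun i j => by rw [H.map_eq (hv i) (hw j), hvw]; simp)
    H.sub_pos (H.latticeGram_eq hw) (H.posDef_latticeGram hv hvv hA) hN
  simpa using this

end HasLatticeCoords

end Coords

end

/-! ### Rank bounds -/

section

open Matrix

section Bounds

variable {F V : Type*} [Field F] [CharZero F] [AddCommGroup V] [Module F V] [Module (𝓞 F) V]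

namespace HasLatticeCoords

variable {Q : QuadraticForm F V} {L : Submodule (𝓞 F) V} {σ τ : F →+* ℝ} {ω ω' : ℝ} {α ν : F → ℤ}
  (H : HasLatticeCoords Q L σ τ ω ω' α ν)

include H

theorem coord_eq_zero_of_rational {m k : ℕ} {v : Fin k → V} {c : Fin k → ℕ} (hv : ∀ i, v i ∈ L)
    (hQ : ∀ i, Q (v i) = ((c i * m : ℕ) : F))
    (hlt : ∀ i j, i < j → 4 * ((c i : ℝ) * c j) * m ^ 2 < (ω - ω') ^ 2) (i j : Fin k) :
    ν (latticeB Q (v i) (v j)) = 0 := by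
  have key : ∀ i j, i < j → ν (latticeB Q (v i) (v j)) = 0 := fun i j hij => by
    refine H.coord_eq_zero (hv i) (hv j) (X := c i * m) (Y := c j * m) (by positivity)
      (by simp [hQ]) (by simp [hQ]) (by simp [hQ]) (by simp [hQ]) ?_
    have := hlt i j hij
    nlinarith
  rcases lt_trichotomy i j with h | rfl | h
  · exact key i j h
  · exact H.coord_snd_self (hv i) (c := 0) (by simp [hQ])
  · rw [latticeB_comm]
    exact key j i h

theorem coord_eq_zero_of_shift {m k l : ℕ} {v : Fin k → V} {c : Fin k → ℕ} {w : Fin l → V}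
    {δ : Fin l → ℝ} {K E : ℝ} (hm : 0 < m) (hv : ∀ i, v i ∈ L) (hw : ∀ j, w j ∈ L)
    (hQ : ∀ i, Q (v i) = ((c i * m : ℕ) : F)) (hσ : ∀ j, σ (Q (w j)) = m * δ j)
    (hτ : ∀ j, τ (Q (w j)) ≤ m) (hδ1 : ∀ j, 1 ≤ δ j) (hc : ∀ i, (c i : ℝ) ≤ K)
    (hδE : ∀ j, δ j ≤ E) (hlt : 4 * K * m ^ 2 * E < (ω - ω') ^ 2) (i : Fin k) (j : Fin l) :
    ν (latticeB Q (v i) (w j)) = 0 := by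
  have hm0 : (0 : ℝ) < m := by exact_mod_cast hm
  -- One bound serves both embeddings, since τ(Q w) ≤ m ≤ mδ; the product XY is at most KEm².
  refine H.coord_eq_zero (hv i) (hw j) (X := c i * m) (Y := m * δ j) (by positivity)
    (by simp [hQ]) (hσ j).le (by simp [hQ]) ((hτ j).trans ?_) ?_
  · nlinarith [hδ1 j]
  · have h1 : (c i : ℝ) * δ j ≤ K * E :=
      mul_le_mul (hc i) (hδE j) (by linarith [hδ1 j]) ((Nat.cast_nonneg _).trans (hc i))
    have h2 := mul_le_mul_of_nonneg_left h1 (sq_nonneg (m : ℝ))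
    nlinarith

/-- Cauchy–Schwarz gives b² ≤ 2m² and the irrationality of √2 makes it strict, so the nondegeneracy
built into C applies. -/
theorem det_coordMatrix_three_ne_zero {m C : ℕ} (hm : 0 < m) {v₁ v₂ v₃ : V} (h₁ : v₁ ∈ L)
    (h₂ : v₂ ∈ L) (h₃ : v₃ ∈ L) (hQ₁ : Q v₁ = m) (hQ₂ : Q v₂ = (2 * m : ℕ))
    (hQ₃ : Q v₃ = (C * m : ℕ)) (h0 : ν (latticeB Q v₁ v₂) = 0)
    (hdet : α (latticeB Q v₁ v₂) ^ 2 < 2 * m ^ 2 → ∀ c e : ℤ,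
      det !![(m : ℤ), α (latticeB Q v₁ v₂), c; α (latticeB Q v₁ v₂), 2 * m, e; c, e, C * m] ≠ 0) :
    α (latticeB Q v₁ v₂) ^ 2 < 2 * (m : ℤ) ^ 2 ∧
      coordMatrix α Q ![v₁, v₂, v₃] = !![(m : ℤ), α (latticeB Q v₁ v₂), α (latticeB Q v₁ v₃);
        α (latticeB Q v₁ v₂), 2 * m, α (latticeB Q v₂ v₃);
        α (latticeB Q v₁ v₃), α (latticeB Q v₂ v₃), C * m] ∧
      (coordMatrix α Q ![v₁, v₂, v₃]).det ≠ 0 := by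
  have hb : α (latticeB Q v₁ v₂) ^ 2 < 2 * (m : ℤ) ^ 2 := by
    refine lt_of_le_of_ne ?_ (sq_ne_two_mul_sq hm _)
    have h := sq_map_latticeB_le H.pos σ h₁ h₂
    rw [H.map_fst v₁ h₁ v₂ h₂, h0, hQ₁, hQ₂] at h
    simp only [Int.cast_zero, zero_mul, add_zero, map_natCast] at h
    have h2 : α (latticeB Q v₁ v₂) ^ 2 ≤ (m : ℤ) * (2 * m : ℕ) := by exact_mod_cast h
    push_cast at h2
    linarith
  have hM := coordMatrix_three α Q v₁ v₂ v₃
  rw [H.coord_fst_self h₁ hQ₁, H.coord_fst_self h₂ hQ₂, H.coord_fst_self h₃ hQ₃] at hM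
  push_cast at hM
  exact ⟨hb, hM, by rw [hM]; exact hdet hb _ _⟩

theorem det_coordMatrix_four_ne_zero {m C D : ℕ} {v₁ v₂ v₃ v₄ : V}
    (h₁ : v₁ ∈ L) (h₂ : v₂ ∈ L) (h₃ : v₃ ∈ L) (h₄ : v₄ ∈ L) (hQ₁ : Q v₁ = m)
    (hQ₂ : Q v₂ = (2 * m : ℕ)) (hQ₃ : Q v₃ = (C * m : ℕ)) (hQ₄ : Q v₄ = (D * m : ℕ))
    (h0 : ∀ i j, ν (latticeB Q (![v₁, v₂, v₃] i) (![v₁, v₂, v₃] j)) = 0)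
    (hne : (coordMatrix α Q ![v₁, v₂, v₃]).det ≠ 0)
    (hdet : 0 < (coordMatrix α Q ![v₁, v₂, v₃]).det → ∀ f g h : ℤ,
      det !![(m : ℤ), α (latticeB Q v₁ v₂), α (latticeB Q v₁ v₃), f;
        α (latticeB Q v₁ v₂), 2 * m, α (latticeB Q v₂ v₃), g;
        α (latticeB Q v₁ v₃), α (latticeB Q v₂ v₃), C * m, h; f, g, h, D * m] ≠ 0) :
    (coordMatrix α Q ![v₁, v₂, v₃, v₄]).det ≠ 0 := by
  have hv : ∀ i, (![v₁, v₂, v₃] : Fin 3 → V) i ∈ L := by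
    intro i; fin_cases i <;> simp [h₁, h₂, h₃]
  have hpos : 0 < (coordMatrix α Q ![v₁, v₂, v₃]).det := by
    refine lt_of_le_of_ne ?_ hne.symm
    have h := (latticeGram_posSemidef H.pos σ hv).det_nonneg
    have h1 : latticeGram Q σ ![v₁, v₂, v₃] =
        (coordMatrix α Q ![v₁, v₂, v₃]).map (Int.cast : ℤ → ℝ) := by
      ext i j
      rw [latticeGram_apply, H.map_fst _ (hv i) _ (hv j), h0]
      simp [coordMatrix]
    have h2 : ((coordMatrix α Q ![v₁, v₂, v₃]).map (Int.cast : ℤ → ℝ)).det =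
      (coordMatrix α Q ![v₁, v₂, v₃]).det := ((Int.castRingHom ℝ).map_det _).symm
    rw [h1, h2] at h
    exact_mod_cast h
  rw [coordMatrix_four, H.coord_fst_self h₁ hQ₁, H.coord_fst_self h₂ hQ₂, H.coord_fst_self h₃ hQ₃,
    H.coord_fst_self h₄ hQ₄]
  push_cast
  exact hdet hpos _ _ _

theorem coordMatrix_posDef_one {m : ℕ} (hm : 0 < m) {w : V} (hw : w ∈ L)
    (h : σ (Q w) - τ (Q w) = (ω - ω') * m) :
    ((coordMatrix ν Q ![w]).map (Int.cast : ℤ → ℝ)).PosDef := by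
  refine coordMatrix_posDef_succ (e' := ![]) (fun i => i.elim0) ?_ ?_
  · exact PosDef.of_dotProduct_mulVec_pos (by ext i; exact i.elim0)
      fun x hx => absurd (Subsingleton.elim x 0) hx
  · change 0 < (coordMatrix ν Q (![w] : Fin 1 → V)).det
    rw [det_fin_one]
    have := H.coord_snd_self hw (c := m) (by exact_mod_cast h)
    simpa [coordMatrix, this] using hm

theorem coordMatrix_posDef_two {m : ℕ} (hm : 0 < m) {w₁ w₂ : V} (h₁ : w₁ ∈ L) (h₂ : w₂ ∈ L)
    (hd₁ : σ (Q w₁) - τ (Q w₁) = (ω - ω') * m)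
    (hd₂ : σ (Q w₂) - τ (Q w₂) = (ω - ω') * (2 * m : ℕ))
    (hτ₁ : τ (Q w₁) ≤ m) (hτ₂ : τ (Q w₂) ≤ m) (hs : 16 * (m : ℝ) ^ 2 < ω - ω') :
    ν (latticeB Q w₁ w₂) ^ 2 < 2 * (m : ℤ) ^ 2 ∧
      ((coordMatrix ν Q ![w₁, w₂]).map (Int.cast : ℤ → ℝ)).PosDef := by
  have hM := coordMatrix_two ν Q w₁ w₂
  rw [H.coord_snd_self h₁ (c := m) (by exact_mod_cast hd₁),
    H.coord_snd_self h₂ (c := (2 * m : ℕ)) (by exact_mod_cast hd₂)] at hM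
  push_cast at hM
  have hN := H.nearly_posSemidef (k := 2) (w := ![w₁, w₂]) (m := m)
    (by intro j; fin_cases j <;> simp [h₁, h₂]) (by positivity)
    (by intro j; fin_cases j <;> simp [hτ₁, hτ₂])
  rw [hM, Nat.cast_ofNat] at hN
  have hb := sq_lt_of_nearly_posSemidef hm hs hN
  refine ⟨hb, coordMatrix_posDef_succ (e' := ![w₁]) ?_ (H.coordMatrix_posDef_one hm h₁ hd₁) ?_⟩
  · intro i; fin_cases i; rfl
  · rw [hM, det_fin_two_of]
    nlinarith

theorem coordMatrix_posDef_three {m C : ℕ} (hm : 0 < m) (hC : 2 ≤ C) {w₁ w₂ w₃ : V} (h₁ : w₁ ∈ L)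
    (h₂ : w₂ ∈ L) (h₃ : w₃ ∈ L) (hd₁ : σ (Q w₁) - τ (Q w₁) = (ω - ω') * m)
    (hd₂ : σ (Q w₂) - τ (Q w₂) = (ω - ω') * (2 * m : ℕ))
    (hd₃ : σ (Q w₃) - τ (Q w₃) = (ω - ω') * (C * m : ℕ))
    (hτ₁ : τ (Q w₁) ≤ m) (hτ₂ : τ (Q w₂) ≤ m) (hτ₃ : τ (Q w₃) ≤ m)
    (hs : 36 * C * (m : ℝ) ^ 3 < ω - ω')
    (hdet : ν (latticeB Q w₁ w₂) ^ 2 < 2 * m ^ 2 → ∀ c e : ℤ,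
      det !![(m : ℤ), ν (latticeB Q w₁ w₂), c; ν (latticeB Q w₁ w₂), 2 * m, e; c, e, C * m] ≠ 0) :
    ν (latticeB Q w₁ w₂) ^ 2 < 2 * (m : ℤ) ^ 2 ∧
      0 < det !![(m : ℤ), ν (latticeB Q w₁ w₂), ν (latticeB Q w₁ w₃);
        ν (latticeB Q w₁ w₂), 2 * m, ν (latticeB Q w₂ w₃);
        ν (latticeB Q w₁ w₃), ν (latticeB Q w₂ w₃), C * m] ∧
      ((coordMatrix ν Q ![w₁, w₂, w₃]).map (Int.cast : ℤ → ℝ)).PosDef := by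
  have hm1 : (1 : ℝ) ≤ m := by exact_mod_cast hm
  have hC2 : (2 : ℝ) ≤ C := by exact_mod_cast hC
  have hs16 : 16 * (m : ℝ) ^ 2 < ω - ω' := by
    refine lt_of_le_of_lt ?_ hs
    calc 16 * (m : ℝ) ^ 2 ≤ 72 * (m : ℝ) ^ 3 := by nlinarith [sq_nonneg (m : ℝ)]
      _ ≤ 36 * C * (m : ℝ) ^ 3 := by gcongr; linarith
  obtain ⟨hb, hPD⟩ := H.coordMatrix_posDef_two hm h₁ h₂ hd₁ hd₂ hτ₁ hτ₂ hs16
  have hM := coordMatrix_three ν Q w₁ w₂ w₃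
  rw [H.coord_snd_self h₁ (c := m) (by exact_mod_cast hd₁),
    H.coord_snd_self h₂ (c := (2 * m : ℕ)) (by exact_mod_cast hd₂),
    H.coord_snd_self h₃ (c := (C * m : ℕ)) (by exact_mod_cast hd₃)] at hM
  push_cast at hM
  have hN := H.nearly_posSemidef (k := 3) (w := ![w₁, w₂, w₃]) (m := m)
    (by intro j; fin_cases j <;> simp [h₁, h₂, h₃]) (by positivity)
    (by intro j; fin_cases j <;> simp [hτ₁, hτ₂, hτ₃])
  rw [hM, Nat.cast_ofNat] at hN
  have hpos := det_ternary_pos_of_nearly_posSemidef hm hC hs hN (hdet hb _ _)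
  refine ⟨hb, hpos, coordMatrix_posDef_succ (e' := ![w₁, w₂]) ?_ hPD (by rw [hM]; exact hpos)⟩
  intro i; fin_cases i <;> rfl

theorem coordMatrix_posDef_four {m C D : ℕ} (hm : 0 < m) (hC : 2 ≤ C) (hD : 1 ≤ D)
    {w₁ w₂ w₃ w₄ : V} (h₁ : w₁ ∈ L) (h₂ : w₂ ∈ L) (h₃ : w₃ ∈ L) (h₄ : w₄ ∈ L)
    (hd₁ : σ (Q w₁) - τ (Q w₁) = (ω - ω') * m)
    (hd₂ : σ (Q w₂) - τ (Q w₂) = (ω - ω') * (2 * m : ℕ))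
    (hd₃ : σ (Q w₃) - τ (Q w₃) = (ω - ω') * (C * m : ℕ))
    (hd₄ : σ (Q w₄) - τ (Q w₄) = (ω - ω') * (D * m : ℕ))
    (hτ₁ : τ (Q w₁) ≤ m) (hτ₂ : τ (Q w₂) ≤ m) (hτ₃ : τ (Q w₃) ≤ m) (hτ₄ : τ (Q w₄) ≤ m)
    (hs : 192 * C * D * (m : ℝ) ^ 4 < ω - ω')
    (hPD : ((coordMatrix ν Q ![w₁, w₂, w₃]).map (Int.cast : ℤ → ℝ)).PosDef)
    (hdet : ∀ f g h : ℤ, det !![(m : ℤ), ν (latticeB Q w₁ w₂), ν (latticeB Q w₁ w₃), f;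
        ν (latticeB Q w₁ w₂), 2 * m, ν (latticeB Q w₂ w₃), g;
        ν (latticeB Q w₁ w₃), ν (latticeB Q w₂ w₃), C * m, h; f, g, h, D * m] ≠ 0) :
    ((coordMatrix ν Q ![w₁, w₂, w₃, w₄]).map (Int.cast : ℤ → ℝ)).PosDef := by
  have hM := coordMatrix_four ν Q w₁ w₂ w₃ w₄
  rw [H.coord_snd_self h₁ (c := m) (by exact_mod_cast hd₁),
    H.coord_snd_self h₂ (c := (2 * m : ℕ)) (by exact_mod_cast hd₂),
    H.coord_snd_self h₃ (c := (C * m : ℕ)) (by exact_mod_cast hd₃),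
    H.coord_snd_self h₄ (c := (D * m : ℕ)) (by exact_mod_cast hd₄)] at hM
  push_cast at hM
  have hN := H.nearly_posSemidef (k := 4) (w := ![w₁, w₂, w₃, w₄]) (m := m)
    (by intro j; fin_cases j <;> simp [h₁, h₂, h₃, h₄]) (by positivity)
    (by intro j; fin_cases j <;> simp [hτ₁, hτ₂, hτ₃, hτ₄])
  rw [hM, Nat.cast_ofNat] at hN
  have hpos := det_quaternary_pos_of_nearly_posSemidef hm hC hD hs hN (hdet _ _ _)
  refine coordMatrix_posDef_succ (e' := ![w₁, w₂, w₃]) ?_ hPD (by rw [hM]; exact hpos)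
  intro i; fin_cases i <;> rfl

end HasLatticeCoords

end Bounds

end

/-! ### The main bound -/

section

open Matrix

section Main

variable {F V : Type*} [Field F] [CharZero F] [AddCommGroup V] [Module F V] [Module (𝓞 F) V]

/-- Since C ≥ 2, the largest product of two distinct entries of (1, 2, C) is 2C. -/
theorem pair_bound_three {C : ℕ} (hC : 2 ≤ C) {t S : ℝ} (ht : 0 ≤ t) (h : 8 * C * t < S) :
    ∀ i j : Fin 3, i < j → 4 * (((![1, 2, C] : Fin 3 → ℕ) i : ℝ) * (![1, 2, C] : Fin 3 → ℕ) j) * t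
      < S := by
  have hC' : (2 : ℝ) ≤ C := by exact_mod_cast hC
  have hCt : 2 * t ≤ C * t := mul_le_mul_of_nonneg_right hC' ht
  intro i j hij
  fin_cases i <;> fin_cases j <;> simp at hij ⊢ <;> linarith

/-- The candidates for the largest product of two entries are 2C, 2D and CD. -/
theorem pair_bound_four {C D : ℕ} (hC : 2 ≤ C) (hD : 1 ≤ D) {t S : ℝ} (ht : 0 ≤ t)
    (h : 8 * C * t < S) (h' : 8 * D * t < S) (h'' : 4 * C * D * t < S) :
    ∀ i j : Fin 4, i < j →
      4 * (((![1, 2, C, D] : Fin 4 → ℕ) i : ℝ) * (![1, 2, C, D] : Fin 4 → ℕ) j) * t < S := by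
  have hC' : (2 : ℝ) ≤ C := by exact_mod_cast hC
  have hD' : (1 : ℝ) ≤ D := by exact_mod_cast hD
  have hCt : 2 * t ≤ C * t := mul_le_mul_of_nonneg_right hC' ht
  have hDt : 1 * t ≤ D * t := mul_le_mul_of_nonneg_right hD' ht
  intro i j hij
  fin_cases i <;> fin_cases j <;> simp at hij ⊢ <;> linarith

set_option maxHeartbeats 1000000 in
/-- The rank bounds, in terms of two embeddings and the values of the lattice under them. -/
theorem HasLatticeCoords.rank_bounds [IsScalarTower (𝓞 F) F V] {Q : QuadraticForm F V}
    {L : Submodule (𝓞 F) V} {σ τ : F →+* ℝ} {ω ω' : ℝ} {α ν : F → ℤ}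
    (H : HasLatticeCoords Q L σ τ ω ω' α ν) (hfg : L.FG) {m : ℕ} (hm : 0 < m) {δ : ℕ → ℝ}
    (hmono : Monotone δ) (hδ : ∀ t : ℕ, t * (ω - ω') ≤ δ t)
    (hint : ∀ c : ℕ, 0 < c → ∃ v ∈ L, Q v = ((c * m : ℕ) : F))
    (hshift : ∀ t : ℕ, 0 < t → ∃ w ∈ L, σ (Q w) = m * δ t ∧ τ (Q w) ≤ m ∧
      σ (Q w) - τ (Q w) = (ω - ω') * (t * m : ℕ)) :
    ∃ p₁ p₂ C₁ C₂ q₁ q₂ D₁ D₂ : ℕ,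
      (p₁.Prime ∧ p₁ ≤ 2 * m ^ 2) ∧ (p₂.Prime ∧ p₂ ≤ 2 * m ^ 2) ∧
      (2 ≤ C₁ ∧ C₁ ≤ leastNonresidue p₁) ∧ (2 ≤ C₂ ∧ C₂ ≤ leastNonresidue p₂) ∧
      (q₁.Prime ∧ q₁ ≤ 2 * C₁ * m ^ 3) ∧ (q₂.Prime ∧ q₂ ≤ 2 * C₂ * m ^ 3) ∧
      (1 ≤ D₁ ∧ D₁ ≤ q₁ * leastNonresidue q₁) ∧ (1 ≤ D₂ ∧ D₂ ≤ q₂ * leastNonresidue q₂) ∧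
      (latticeRank L ≤ 3 → (ω - ω') ^ 2 ≤ 4 * C₁ * m ^ 2 * δ 1) ∧
      (latticeRank L ≤ 4 → (ω - ω') ^ 2 ≤ 4 * C₁ * m ^ 2 * δ 2) ∧
      (latticeRank L ≤ 5 → (ω - ω') ^ 2 ≤ 4 * C₁ * m ^ 2 * δ C₂ ∨
        (ω - ω') ^ 3 ≤ 36 * C₂ * m ^ 3 * (ω - ω') ^ 2) ∧
      (latticeRank L ≤ 6 → (ω - ω') ^ 2 ≤ 4 * C₁ * m ^ 2 * δ C₂ ∨
        (ω - ω') ^ 3 ≤ 36 * C₂ * m ^ 3 * (ω - ω') ^ 2 ∨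
        (ω - ω') ^ 2 ≤ 4 * D₁ * m ^ 2 * max (C₁ : ℝ) (δ C₂)) ∧
      (latticeRank L ≤ 7 → (ω - ω') ^ 2 ≤ 4 * C₁ * D₁ * m ^ 2 ∨
        (ω - ω') ^ 2 ≤ 4 * max (C₁ : ℝ) (D₁ : ℝ) * m ^ 2 * max (δ C₂) (δ D₂) ∨
        (ω - ω') ^ 3 ≤ 36 * C₂ * m ^ 3 * (ω - ω') ^ 2 ∨
        (ω - ω') ^ 4 ≤ 192 * C₂ * D₂ * m ^ 4 * (ω - ω') ^ 3) := by
  have hs2 := H.two_le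
  have hs0 := H.sub_pos
  have hδ2 : ∀ t : ℕ, 1 ≤ t → 2 ≤ δ t := fun t ht => by
    have h1 : (1 : ℝ) ≤ t := by exact_mod_cast ht
    nlinarith [hδ t]
  have hm1 : (1 : ℝ) ≤ m := by exact_mod_cast hm
  have hmm : (1 : ℝ) ≤ (m : ℝ) ^ 2 := one_le_pow₀ hm1
  -- The order of choices matters: C₁ depends on the product of v₁ and v₂, and D₁ on the Gram matrix
  -- of v₁, v₂, v₃. The same holds for C₂, D₂ and the ω-coordinates of the w's.
  obtain ⟨v₁, hv₁, hQ₁⟩ := hint 1 one_pos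
  obtain ⟨v₂, hv₂, hQ₂⟩ := hint 2 two_pos
  obtain ⟨p₁, C₁, hp₁, hC₁, hdetV⟩ := exists_nondegenerate_ternary hm (α (latticeB Q v₁ v₂))
  obtain ⟨v₃, hv₃, hQ₃⟩ := hint C₁ (by omega)
  obtain ⟨q₁, D₁, hq₁, hD₁, hdetV'⟩ := exists_nondegenerate_quaternary (C := C₁) hm (by omega)
    (α (latticeB Q v₁ v₂)) (α (latticeB Q v₁ v₃)) (α (latticeB Q v₂ v₃))
  obtain ⟨v₄, hv₄, hQ₄⟩ := hint D₁ (by omega)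
  obtain ⟨w₁, hw₁, hσ₁, hτ₁, hd₁⟩ := hshift 1 one_pos
  obtain ⟨w₂, hw₂, hσ₂, hτ₂, hd₂⟩ := hshift 2 two_pos
  obtain ⟨p₂, C₂, hp₂, hC₂, hdetW⟩ := exists_nondegenerate_ternary hm (ν (latticeB Q w₁ w₂))
  obtain ⟨w₃, hw₃, hσ₃, hτ₃, hd₃⟩ := hshift C₂ (by omega)
  obtain ⟨q₂, D₂, hq₂, hD₂, hdetW'⟩ := exists_nondegenerate_quaternary (C := C₂) hm (by omega)
    (ν (latticeB Q w₁ w₂)) (ν (latticeB Q w₁ w₃)) (ν (latticeB Q w₂ w₃))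
  obtain ⟨w₄, hw₄, hσ₄, hτ₄, hd₄⟩ := hshift D₂ (by omega)
  have hQ₁' : Q v₁ = m := by rw [hQ₁, one_mul]
  have hd₁' : σ (Q w₁) - τ (Q w₁) = (ω - ω') * m := by rw [hd₁, one_mul]
  have hC₁' : (2 : ℝ) ≤ C₁ := by exact_mod_cast hC₁.1
  have hC₂' : (2 : ℝ) ≤ C₂ := by exact_mod_cast hC₂.1
  have hD₁' : (1 : ℝ) ≤ D₁ := by exact_mod_cast hD₁.1
  have hD₂' : (1 : ℝ) ≤ D₂ := by exact_mod_cast hD₂.1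
  have hδ12 : δ 1 ≤ δ 2 := hmono (by norm_num)
  have hδ2C : δ 2 ≤ δ C₂ := hmono hC₂.1
  have hv3 : ∀ i, (![v₁, v₂, v₃] : Fin 3 → V) i ∈ L := by
    intro i; fin_cases i <;> simp [hv₁, hv₂, hv₃]
  have hv4 : ∀ i, (![v₁, v₂, v₃, v₄] : Fin 4 → V) i ∈ L := by
    intro i; fin_cases i <;> simp [hv₁, hv₂, hv₃, hv₄]
  have hQ3 : ∀ i, Q ((![v₁, v₂, v₃] : Fin 3 → V) i) = ((![1, 2, C₁] i * m : ℕ) : F) := by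
    intro i; fin_cases i <;> simp [hQ₁', hQ₂, hQ₃]
  have hQ4 : ∀ i, Q ((![v₁, v₂, v₃, v₄] : Fin 4 → V) i) = ((![1, 2, C₁, D₁] i * m : ℕ) : F) := by
    intro i; fin_cases i <;> simp [hQ₁', hQ₂, hQ₃, hQ₄]
  have hV3 : 8 * C₁ * (m : ℝ) ^ 2 < (ω - ω') ^ 2 →
      (∀ i j, ν (latticeB Q ((![v₁, v₂, v₃] : Fin 3 → V) i) (![v₁, v₂, v₃] j)) = 0) ∧
        (α (latticeB Q v₁ v₂) ^ 2 < 2 * (m : ℤ) ^ 2) ∧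
        coordMatrix α Q ![v₁, v₂, v₃] = !![(m : ℤ), α (latticeB Q v₁ v₂), α (latticeB Q v₁ v₃);
          α (latticeB Q v₁ v₂), 2 * m, α (latticeB Q v₂ v₃);
          α (latticeB Q v₁ v₃), α (latticeB Q v₂ v₃), C₁ * m] ∧
        (coordMatrix α Q ![v₁, v₂, v₃]).det ≠ 0 := by
    intro hlt
    have h0 := H.coord_eq_zero_of_rational hv3 hQ3 (pair_bound_three hC₁.1 (by positivity) hlt)
    exact ⟨h0, H.det_coordMatrix_three_ne_zero hm hv₁ hv₂ hv₃ hQ₁' hQ₂ hQ₃ (h0 0 1) hdetV⟩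
  have hV4 : 8 * C₁ * (m : ℝ) ^ 2 < (ω - ω') ^ 2 → 8 * D₁ * (m : ℝ) ^ 2 < (ω - ω') ^ 2 →
      4 * C₁ * D₁ * (m : ℝ) ^ 2 < (ω - ω') ^ 2 →
      (∀ i j, ν (latticeB Q ((![v₁, v₂, v₃, v₄] : Fin 4 → V) i) (![v₁, v₂, v₃, v₄] j)) = 0) ∧
        (coordMatrix α Q ![v₁, v₂, v₃, v₄]).det ≠ 0 := by
    intro hlt1 hlt2 hlt3
    obtain ⟨h0, hb, hM, hne⟩ := hV3 hlt1
    refine ⟨H.coord_eq_zero_of_rational hv4 hQ4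
      (pair_bound_four hC₁.1 hD₁.1 (by positivity) hlt1 hlt2 hlt3), ?_⟩
    refine H.det_coordMatrix_four_ne_zero hv₁ hv₂ hv₃ hv₄ hQ₁' hQ₂ hQ₃ hQ₄ h0 hne fun hpos => ?_
    rw [hM] at hpos
    exact hdetV' hb hpos
  have hW3 : 36 * C₂ * (m : ℝ) ^ 3 < ω - ω' → _ := fun hlt =>
    H.coordMatrix_posDef_three hm hC₂.1 hw₁ hw₂ hw₃ hd₁' hd₂ hd₃ hτ₁ hτ₂ hτ₃ hlt hdetW
  have hcubic : ¬ (ω - ω') ^ 3 ≤ 36 * C₂ * m ^ 3 * (ω - ω') ^ 2 →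
      36 * C₂ * (m : ℝ) ^ 3 < ω - ω' := by
    intro h
    by_contra hle
    apply h
    calc (ω - ω') ^ 3 = (ω - ω') * (ω - ω') ^ 2 := by ring
      _ ≤ _ := mul_le_mul_of_nonneg_right (not_lt.1 hle) (by positivity)
  have hquartic : ¬ (ω - ω') ^ 4 ≤ 192 * C₂ * D₂ * m ^ 4 * (ω - ω') ^ 3 →
      192 * C₂ * D₂ * (m : ℝ) ^ 4 < ω - ω' := by
    intro h
    by_contra hle
    apply h
    calc (ω - ω') ^ 4 = (ω - ω') * (ω - ω') ^ 3 := by ring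
      _ ≤ _ := mul_le_mul_of_nonneg_right (not_lt.1 hle) (by positivity)
  -- Every δ t with t ≥ 1 is at least 2, so the condition for the mixed products already implies the
  -- one for the pair (2, K) of rational norms.
  have h8 : ∀ {K E : ℝ}, 0 ≤ K → 2 ≤ E → 4 * K * (m : ℝ) ^ 2 * E < (ω - ω') ^ 2 →
      8 * K * (m : ℝ) ^ 2 < (ω - ω') ^ 2 := fun {K E} hK hE h => by
    have : K * (m : ℝ) ^ 2 * 2 ≤ K * (m : ℝ) ^ 2 * E := mul_le_mul_of_nonneg_left hE (by positivity)
    linarith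
  have hw1 : ∀ j, (![w₁] : Fin 1 → V) j ∈ L := by
    intro i; fin_cases i; exact hw₁
  have hw2 : ∀ j, (![w₁, w₂] : Fin 2 → V) j ∈ L := by
    intro i; fin_cases i <;> simp [hw₁, hw₂]
  have hw3 : ∀ j, (![w₁, w₂, w₃] : Fin 3 → V) j ∈ L := by
    intro i; fin_cases i <;> simp [hw₁, hw₂, hw₃]
  have hw4 : ∀ j, (![w₁, w₂, w₃, w₄] : Fin 4 → V) j ∈ L := by
    intro i; fin_cases i <;> simp [hw₁, hw₂, hw₃, hw₄]
  refine ⟨p₁, p₂, C₁, C₂, q₁, q₂, D₁, D₂, hp₁, hp₂, hC₁, hC₂, hq₁, hq₂, hD₁, hD₂,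
    fun hr => ?_, fun hr => ?_, fun hr => ?_, fun hr => ?_, fun hr => ?_⟩
  · by_contra h
    rw [not_le] at h
    obtain ⟨h0, -, -, hne⟩ := hV3 (h8 (by positivity) (hδ2 1 le_rfl) h)
    have hvw := H.coord_eq_zero_of_shift (δ := ![δ 1]) (K := C₁) (E := δ 1) hm hv3 hw1 hQ3
      (by intro j; fin_cases j; exact hσ₁) (by intro j; fin_cases j; exact hτ₁)
      (by intro j; fin_cases j; simp; linarith [hδ2 1 le_rfl])
      (by intro i; fin_cases i <;> simp <;> linarith) (by intro j; fin_cases j; simp) h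
    have := H.add_le_latticeRank hfg hv3 hw1 h0 hvw hne (H.coordMatrix_posDef_one hm hw₁ hd₁')
    omega
  · by_contra h
    rw [not_le] at h
    obtain ⟨h0, -, -, hne⟩ := hV3 (h8 (by positivity) (hδ2 2 (by norm_num)) h)
    have hvw := H.coord_eq_zero_of_shift (δ := ![δ 1, δ 2]) (K := C₁) (E := δ 2) hm hv3 hw2 hQ3
      (by intro j; fin_cases j <;> simp [hσ₁, hσ₂]) (by intro j; fin_cases j <;> simp [hτ₁, hτ₂])
      (by intro j; fin_cases j <;> simp <;> linarith [hδ2 1 le_rfl, hδ2 2 (by norm_num)])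
      (by intro i; fin_cases i <;> simp <;> linarith)
      (by intro j; fin_cases j; exacts [hδ12, le_rfl]) h
    -- No separate hypothesis on s is needed: δ 2 ≥ 2s and C₁ ≥ 2 give s² > 4C₁m²·2s ≥ 16m²s.
    have hs16 : 16 * (m : ℝ) ^ 2 < ω - ω' := by
      have h1 : 4 * C₁ * (m : ℝ) ^ 2 * (2 * (ω - ω')) ≤ 4 * C₁ * (m : ℝ) ^ 2 * δ 2 :=
        mul_le_mul_of_nonneg_left (by exact_mod_cast hδ 2) (by positivity)
      have h2 : 16 * (m : ℝ) ^ 2 * (ω - ω') ≤ 4 * C₁ * (m : ℝ) ^ 2 * (2 * (ω - ω')) := by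
        have : 2 * ((m : ℝ) ^ 2 * (ω - ω')) ≤ C₁ * ((m : ℝ) ^ 2 * (ω - ω')) :=
          mul_le_mul_of_nonneg_right hC₁' (by positivity)
        linarith
      have h3 : 16 * (m : ℝ) ^ 2 * (ω - ω') < (ω - ω') * (ω - ω') := by nlinarith
      exact lt_of_mul_lt_mul_right h3 hs0.le
    have := H.add_le_latticeRank hfg hv3 hw2 h0 hvw hne
      (H.coordMatrix_posDef_two hm hw₁ hw₂ hd₁' hd₂ hτ₁ hτ₂ hs16).2
    omega
  · by_contra h
    rw [not_or] at h
    obtain ⟨h, hcub⟩ := h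
    rw [not_le] at h
    obtain ⟨h0, -, -, hne⟩ := hV3 (h8 (by positivity) (hδ2 C₂ (by omega)) h)
    have hvw := H.coord_eq_zero_of_shift (δ := ![δ 1, δ 2, δ C₂]) (K := C₁) (E := δ C₂) hm hv3 hw3
      hQ3 (by intro j; fin_cases j <;> simp [hσ₁, hσ₂, hσ₃])
      (by intro j; fin_cases j <;> simp [hτ₁, hτ₂, hτ₃])
      (by intro j; fin_cases j <;> simp <;> linarith [hδ2 1 le_rfl])
      (by intro i; fin_cases i <;> simp <;> linarith)
      (by intro j; fin_cases j <;> simp <;> linarith) h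
    have := H.add_le_latticeRank hfg hv3 hw3 h0 hvw hne (hW3 (hcubic hcub)).2.2
    omega
  · by_contra h
    rw [not_or, not_or] at h
    obtain ⟨h, hcub, h'⟩ := h
    rw [not_le] at h h'
    have hE := hδ2 C₂ (by omega)
    have hD1C : 4 * C₁ * D₁ * (m : ℝ) ^ 2 < (ω - ω') ^ 2 := by
      refine lt_of_le_of_lt ?_ h'
      have : 4 * D₁ * (m : ℝ) ^ 2 * C₁ ≤ 4 * D₁ * (m : ℝ) ^ 2 * max (C₁ : ℝ) (δ C₂) :=
        mul_le_mul_of_nonneg_left (le_max_left _ _) (by positivity)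
      linarith
    have hD1δ : 4 * D₁ * (m : ℝ) ^ 2 * δ C₂ < (ω - ω') ^ 2 := by
      refine lt_of_le_of_lt ?_ h'
      exact mul_le_mul_of_nonneg_left (le_max_right _ _) (by positivity)
    obtain ⟨h0, hne⟩ := hV4 (h8 (by positivity) hE h) (h8 (by positivity) hE hD1δ) hD1C
    -- The maximum is C₁ or D₁; the negated first and third alternatives cover one case each.
    have hmax : 4 * max (C₁ : ℝ) D₁ * (m : ℝ) ^ 2 * δ C₂ < (ω - ω') ^ 2 := by
      rcases max_choice (C₁ : ℝ) D₁ with e | e <;> rw [e] <;> assumption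
    have hvw := H.coord_eq_zero_of_shift (δ := ![δ 1, δ 2, δ C₂]) (K := max (C₁ : ℝ) D₁)
      (E := δ C₂) hm hv4 hw3 hQ4 (by intro j; fin_cases j <;> simp [hσ₁, hσ₂, hσ₃])
      (by intro j; fin_cases j <;> simp [hτ₁, hτ₂, hτ₃])
      (by intro j; fin_cases j <;> simp <;> linarith [hδ2 1 le_rfl])
      (by
        have := le_max_left (C₁ : ℝ) D₁
        intro i
        fin_cases i
        · change ((1 : ℕ) : ℝ) ≤ _; push_cast; linarith
        · change ((2 : ℕ) : ℝ) ≤ _; push_cast; linarith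
        · exact le_max_left _ _
        · exact le_max_right _ _)
      (by intro j; fin_cases j <;> simp <;> linarith) hmax
    have := H.add_le_latticeRank hfg hv4 hw3 h0 hvw hne (hW3 (hcubic hcub)).2.2
    omega
  · by_contra h
    rw [not_or, not_or, not_or] at h
    obtain ⟨h, hmax, hcub, hqu⟩ := h
    rw [not_le] at h hmax
    have hE : 2 ≤ max (δ C₂) (δ D₂) := (hδ2 C₂ (by omega)).trans (le_max_left _ _)
    have hK := h8 (by positivity) hE hmax
    have hKC : 8 * C₁ * (m : ℝ) ^ 2 < (ω - ω') ^ 2 := by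
      refine lt_of_le_of_lt ?_ hK
      have := le_max_left (C₁ : ℝ) D₁
      gcongr
    have hKD : 8 * D₁ * (m : ℝ) ^ 2 < (ω - ω') ^ 2 := by
      refine lt_of_le_of_lt ?_ hK
      have := le_max_right (C₁ : ℝ) D₁
      gcongr
    obtain ⟨h0, hne⟩ := hV4 hKC hKD h
    have hvw := H.coord_eq_zero_of_shift (δ := ![δ 1, δ 2, δ C₂, δ D₂]) (K := max (C₁ : ℝ) D₁)
      (E := max (δ C₂) (δ D₂)) hm hv4 hw4 hQ4
      (by intro j; fin_cases j <;> simp [hσ₁, hσ₂, hσ₃, hσ₄])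
      (by intro j; fin_cases j <;> simp [hτ₁, hτ₂, hτ₃, hτ₄])
      (by intro j; fin_cases j <;> simp <;> linarith [hδ2 1 le_rfl, hδ2 D₂ hD₂.1])
      (by
        have := le_max_left (C₁ : ℝ) D₁
        intro i
        fin_cases i
        · change ((1 : ℕ) : ℝ) ≤ _; push_cast; linarith
        · change ((2 : ℕ) : ℝ) ≤ _; push_cast; linarith
        · exact le_max_left _ _
        · exact le_max_right _ _)
      (by
        have := le_max_left (δ C₂) (δ D₂)
        intro j
        fin_cases j
        · change δ 1 ≤ _; linarith
        · change δ 2 ≤ _; linarith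
        · exact le_max_left _ _
        · exact le_max_right _ _) hmax
    obtain ⟨hb, hpos, hPD⟩ := hW3 (hcubic hcub)
    have := H.add_le_latticeRank hfg hv4 hw4 h0 hvw hne
      (H.coordMatrix_posDef_four hm hC₂.1 hD₂.1 hw₁ hw₂ hw₃ hw₄ hd₁' hd₂ hd₃ hd₄ hτ₁ hτ₂ hτ₃ hτ₄
        (hquartic hqu) hPD (hdetW' hb hpos))
    omega

end Main

end

/-! ### Shifts of multiples of `ω` -/

theorem two_le_of_squarefree {D : ℕ} (hD : D ≠ 1) (hsq : Squarefree D) : 2 ≤ D := by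
  have := hsq.ne_zero
  omega

theorem quadOmega_sub_quadOmegaConj (D : ℕ) :
    quadOmega D - quadOmegaConj D = √(quadDisc D : ℝ) := by
  rw [quadOmega, quadOmegaConj, quadDisc]
  split_ifs
  · ring
  · push_cast
    rw [Real.sqrt_mul (by norm_num), show (4 : ℝ) = 2 ^ 2 by norm_num,
      Real.sqrt_sq (by norm_num)]
    ring

theorem two_le_sqrt_quadDisc {D : ℕ} (hD : 2 ≤ D) : 2 ≤ √(quadDisc D : ℝ) := by
  apply Real.le_sqrt_of_sq_le
  have : 4 ≤ quadDisc D := by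
    rw [quadDisc]
    split_ifs <;> omega
  have h4 : (4 : ℝ) ≤ quadDisc D := by exact_mod_cast this
  linarith

theorem quadOmega_nonneg (D : ℕ) : 0 ≤ quadOmega D := by
  have := Real.sqrt_nonneg (D : ℝ)
  rw [quadOmega]
  split_ifs <;> positivity

theorem quadOmegaConj_nonpos {D : ℕ} (hD : 2 ≤ D) : quadOmegaConj D ≤ 0 := by
  have h0 := Real.sqrt_nonneg (D : ℝ)
  have h1 : 1 ≤ √(D : ℝ) := by
    rw [Real.one_le_sqrt]
    exact_mod_cast (by omega : 1 ≤ D)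
  rw [quadOmegaConj]
  split_ifs <;> linarith

/-- The fractional part of tω' is the conjugate of tω − ⌊tω'⌋, so the two conjugates differ by
exactly t√Δ. -/
theorem quadShift_eq (D t : ℕ) : quadShift D t =
    t * (quadOmega D - quadOmegaConj D) + Int.fract (t * quadOmegaConj D) := by
  rw [quadShift, Int.fract]
  ring

theorem quadShift_monotone {D : ℕ} (hD : 2 ≤ D) : Monotone (quadShift D) := by
  intro a b hab
  have hab' : (a : ℝ) ≤ b := by exact_mod_cast hab
  rw [quadShift, quadShift]
  have h1 := mul_le_mul_of_nonneg_right hab' (quadOmega_nonneg D)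
  have h2 : ⌊(b : ℝ) * quadOmegaConj D⌋ ≤ ⌊(a : ℝ) * quadOmegaConj D⌋ :=
    Int.floor_le_floor (mul_le_mul_of_nonpos_right hab' (quadOmegaConj_nonpos hD))
  have h3 : (⌊(b : ℝ) * quadOmegaConj D⌋ : ℝ) ≤ ⌊(a : ℝ) * quadOmegaConj D⌋ := by
    exact_mod_cast h2
  linarith

/-- Strict positivity, from the irrationality of √D, is what makes tω − ⌊tω'⌋ totally positive. -/
theorem fract_quadOmegaConj_pos {D : ℕ} (h : Irrational √(D : ℝ)) {t : ℕ} (ht : 0 < t) :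
    0 < Int.fract ((t : ℝ) * quadOmegaConj D) := by
  refine lt_of_le_of_ne (Int.fract_nonneg _) fun h0 => ?_
  obtain ⟨k, hk⟩ := Int.fract_eq_zero_iff.1 h0.symm
  have ht' : (t : ℝ) ≠ 0 := by positivity
  rw [quadOmegaConj] at hk
  split_ifs at hk
  · refine h ⟨1 - 2 * k / t, ?_⟩
    push_cast
    rw [hk]
    field_simp
    ring
  · refine h ⟨-(k / t), ?_⟩
    push_cast
    rw [hk]
    field_simp

/-! ### The bounds for lattices over ℚ(√D) -/

theorem mainTheorem3 (m D : ℕ) (hm : 0 < m) (hD : D ≠ 1) (hDsq : Squarefree D)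
    {V : Type*} [AddCommGroup V] [Module (RealQuadField D) V]
    [Module (𝓞 (RealQuadField D)) V]
    [IsScalarTower (𝓞 (RealQuadField D)) (RealQuadField D) V]
    (Q : QuadraticForm (RealQuadField D) V) (L : Submodule (𝓞 (RealQuadField D)) V)
    (hL : IsQuadraticLattice Q L) (hclassical : IsClassicalLattice Q L)
    (hpos : IsTotPosDefLattice Q L) (hrep : RepresentsMultiples Q L m) :
    ∃ p₁ p₂ C₁ C₂ q₁ q₂ D₁ D₂ : ℕ,
      (p₁.Prime ∧ p₁ ≤ 2 * m ^ 2) ∧ (p₂.Prime ∧ p₂ ≤ 2 * m ^ 2) ∧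
      (2 ≤ C₁ ∧ C₁ ≤ leastNonresidue p₁) ∧ (2 ≤ C₂ ∧ C₂ ≤ leastNonresidue p₂) ∧
      (q₁.Prime ∧ q₁ ≤ 2 * C₁ * m ^ 3) ∧ (q₂.Prime ∧ q₂ ≤ 2 * C₂ * m ^ 3) ∧
      (1 ≤ D₁ ∧ D₁ ≤ q₁ * leastNonresidue q₁) ∧ (1 ≤ D₂ ∧ D₂ ≤ q₂ * leastNonresidue q₂) ∧
      (latticeRank L ≤ 3 →
        (quadDisc D : ℝ) ≤ 4 * C₁ * m ^ 2 * quadShift D 1) ∧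
      (latticeRank L ≤ 4 →
        (quadDisc D : ℝ) ≤ 4 * C₁ * m ^ 2 * quadShift D 2) ∧
      (latticeRank L ≤ 5 →
        (quadDisc D : ℝ) ≤ 4 * C₁ * m ^ 2 * quadShift D C₂ ∨
        √(quadDisc D : ℝ) ^ 3 ≤ 36 * C₂ * m ^ 3 * √(quadDisc D : ℝ) ^ 2
          + 18 * C₂ * m ^ 3 * √(quadDisc D : ℝ) + m ^ 3) ∧
      (latticeRank L ≤ 6 →
        (quadDisc D : ℝ) ≤ 4 * C₁ * m ^ 2 * quadShift D C₂ ∨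
        √(quadDisc D : ℝ) ^ 3 ≤ 36 * C₂ * m ^ 3 * √(quadDisc D : ℝ) ^ 2
          + 18 * C₂ * m ^ 3 * √(quadDisc D : ℝ) + m ^ 3 ∨
        (quadDisc D : ℝ) ≤ 4 * D₁ * m ^ 2 * max (C₁ : ℝ) (quadShift D C₂)) ∧
      (latticeRank L ≤ 7 →
        (quadDisc D : ℝ) ≤ 4 * C₁ * D₁ * m ^ 2 ∨
        (quadDisc D : ℝ) ≤ 4 * max (C₁ : ℝ) (D₁ : ℝ) * m ^ 2
          * max (quadShift D C₂) (quadShift D D₂) ∨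
        √(quadDisc D : ℝ) ^ 3 ≤ 36 * C₂ * m ^ 3 * √(quadDisc D : ℝ) ^ 2
          + 18 * C₂ * m ^ 3 * √(quadDisc D : ℝ) + m ^ 3 ∨
        √(quadDisc D : ℝ) ^ 4 ≤ 192 * C₂ * D₂ * m ^ 4 * √(quadDisc D : ℝ) ^ 3
          + 144 * C₂ * D₂ * m ^ 4 * √(quadDisc D : ℝ) ^ 2
          + 96 * max (C₂ : ℝ) (D₂ : ℝ) * m ^ 4 * √(quadDisc D : ℝ) + m ^ 4) := by
  have hD2 := two_le_of_squarefree hD hDsq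
  have hirr := irrational_sqrt_of_squarefree hD hDsq
  obtain ⟨τ, hτ⟩ := exists_quadConj hirr
  have hemb : ∀ ρ : RealQuadField D →+* ℝ, ρ = algebraMap (RealQuadField D) ℝ ∨ ρ = τ := by
    intro ρ
    rcases ringHom_quadGen ρ with h | h
    · exact Or.inl (ringHom_quad_eq (by rw [h]; rfl))
    · exact Or.inr (ringHom_quad_eq (by rw [h, hτ]))
  -- Coordinates are extended by 0 to non-integral x, so that they become functions on the whole
  -- field; only products of lattice vectors, integral by classicality, are ever evaluated.
  have hcoord : ∀ x : RealQuadField D, ∃ a n : ℤ, (∃ y : 𝓞 (RealQuadField D), x = y) →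
      algebraMap (RealQuadField D) ℝ x = a + n * quadOmega D ∧
        τ x = a + n * quadOmegaConj D := by
    intro x
    by_cases hx : ∃ y : 𝓞 (RealQuadField D), x = y
    · obtain ⟨y, rfl⟩ := hx
      obtain ⟨a, n, h⟩ := exists_int_coords hDsq hτ y
      exact ⟨a, n, fun _ => h⟩
    · exact ⟨0, 0, fun h => absurd h hx⟩
  choose α ν hαν using hcoord
  have hω := quadOmega_sub_quadOmegaConj D
  have H : HasLatticeCoords Q L (algebraMap (RealQuadField D) ℝ) τ (quadOmega D)
      (quadOmegaConj D) α ν :=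
    { pos := hpos
      two_le := by rw [hω]; exact two_le_sqrt_quadDisc hD2
      map_fst := fun v hv w hw => (hαν _ (hclassical v hv w hw)).1
      map_snd := fun v hv w hw => (hαν _ (hclassical v hv w hw)).2 }
  obtain ⟨p₁, p₂, C₁, C₂, q₁, q₂, D₁, D₂, hp₁, hp₂, hC₁, hC₂, hq₁, hq₂, hD₁, hD₂, h3, h4, h5, h6,
    h7⟩ := H.rank_bounds hL.fg hm (quadShift_monotone hD2)
    (fun t => by
      rw [quadShift_eq]
      linarith [Int.fract_nonneg ((t : ℝ) * quadOmegaConj D)])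
    (fun c hc => by
      obtain ⟨v, hv, hQ⟩ := hrep (c : 𝓞 (RealQuadField D)) (fun ρ => by simpa using hc)
      exact ⟨v, hv, by rw [hQ]; simp [mul_comm]⟩)
    (fun t ht => by
      -- x = tω − ⌊tω'⌋ is the integer with ω-coordinate t whose conjugate lies in (0, 1).
      obtain ⟨x, hx, hx'⟩ := exists_ringOfIntegers_coords hτ
        (-⌊(t : ℝ) * quadOmegaConj D⌋) (t : ℤ)
      have e1 : algebraMap (RealQuadField D) ℝ x = quadShift D t := by
        rw [hx, quadShift]; push_cast; ring
      have e2 : τ x = Int.fract ((t : ℝ) * quadOmegaConj D) := by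
        rw [hx', Int.fract]; push_cast; ring
      have hfr := fract_quadOmegaConj_pos hirr ht
      have hsh : 0 < quadShift D t := by
        rw [quadShift_eq]
        have := H.sub_pos
        positivity
      obtain ⟨w, hw, hQ⟩ := hrep x (fun ρ => by
        rcases hemb ρ with rfl | rfl
        · exact e1 ▸ hsh
        · exact e2 ▸ hfr)
      have e1' : algebraMap (RealQuadField D) ℝ (Q w) = m * quadShift D t := by
        rw [hQ, map_mul, map_natCast, ← e1]
      have e2' : τ (Q w) = m * Int.fract ((t : ℝ) * quadOmegaConj D) := by
        rw [hQ, map_mul, map_natCast, ← e2]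
      refine ⟨w, hw, e1', ?_, ?_⟩
      · rw [e2']
        exact mul_le_of_le_one_right (by positivity) (Int.fract_lt_one _).le
      · rw [e1', e2', quadShift_eq]
        push_cast
        ring)
  rw [hω] at h3 h4 h5 h6 h7
  have hsq : √(quadDisc D : ℝ) ^ 2 = quadDisc D := Real.sq_sqrt (Nat.cast_nonneg _)
  -- The bound obtained has only the leading term; the lower-order terms of the stated inequality
  -- are nonnegative and merely weaken it.
  have hcub : ∀ {x : ℝ}, x ≤ 36 * C₂ * m ^ 3 * √(quadDisc D : ℝ) ^ 2 →
      x ≤ 36 * C₂ * m ^ 3 * √(quadDisc D : ℝ) ^ 2 + 18 * C₂ * m ^ 3 * √(quadDisc D : ℝ) + m ^ 3 :=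
    fun {x} hx => by
      have : 0 ≤ 18 * (C₂ : ℝ) * m ^ 3 * √(quadDisc D : ℝ) + m ^ 3 := by positivity
      linarith
  have hqua : ∀ {x : ℝ}, x ≤ 192 * C₂ * D₂ * m ^ 4 * √(quadDisc D : ℝ) ^ 3 →
      x ≤ 192 * C₂ * D₂ * m ^ 4 * √(quadDisc D : ℝ) ^ 3
          + 144 * C₂ * D₂ * m ^ 4 * √(quadDisc D : ℝ) ^ 2
          + 96 * max (C₂ : ℝ) (D₂ : ℝ) * m ^ 4 * √(quadDisc D : ℝ) + m ^ 4 :=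
    fun {x} hx => by
      have : 0 ≤ 144 * (C₂ : ℝ) * D₂ * m ^ 4 * √(quadDisc D : ℝ) ^ 2
          + 96 * max (C₂ : ℝ) (D₂ : ℝ) * m ^ 4 * √(quadDisc D : ℝ) + m ^ 4 := by positivity
      linarith
  refine ⟨p₁, p₂, C₁, C₂, q₁, q₂, D₁, D₂, hp₁, hp₂, hC₁, hC₂, hq₁, hq₂, hD₁, hD₂, fun hr => ?_,
    fun hr => ?_, fun hr => ?_, fun hr => ?_, fun hr => ?_⟩
  · exact hsq ▸ h3 hr
  · exact hsq ▸ h4 hr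
  · rcases h5 hr with h | h
    · exact Or.inl (hsq ▸ h)
    · exact Or.inr (hcub h)
  · rcases h6 hr with h | h | h
    · exact Or.inl (hsq ▸ h)
    · exact Or.inr (Or.inl (hcub h))
    · exact Or.inr (Or.inr (hsq ▸ h))
  · rcases h7 hr with h | h | h | h
    · exact Or.inl (hsq ▸ h)
    · exact Or.inr (Or.inl (hsq ▸ h))
    · exact Or.inr (Or.inr (Or.inl (hcub h)))
    · exact Or.inr (Or.inr (Or.inr (hqua h)))
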